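/- Let $d\ge 2$, $s\in(0,1)$ and $\gamma\in\mathbb R$ with $\gamma+2s\in[0,2]$. Fix a non-cutoff collision kernel $B(r,\cos\theta)=r^{\gamma}b(\cos\theta)$ with $$2^{d-1}\,b(\cos\theta)=\big(\sin\tfrac\theta2\big)^{-(d-1)-2s}\big(\cos\tfrac\theta2\big)^{\gamma+2s+1}\,\tilde b(\theta),\qquad \theta\in(0,\pi),$$ where $\tilde b$ is smooth on $[0,\pi]$ and strictly positive on $[0,\pi)$. For functions $g,h$ on $\mathbb R^d$ with $g \geq 0$ put $$Q_s(g,h)(v)=\mathrm{p.v.}\!\int_{\mathbb R^d}K_g(v,v')\,[h(v')-h(v)]\,dv',\qquad K_g(v,v')=\frac{2^{d-1}}{|v'-v|}\int_{v+(v'-v)^{\perp}}g(v'_*)\,|v-v_*|^{\gamma-(d-2)}\,b(\cos\theta)\,dv'_*,$$ where $v_*=v'+v'_*-v$, $\cos\theta=\frac{v-v_*}{|v-v_*|}\cdot\frac{v'-v'_*}{|v'-v'_*|}$, the inner integral is with respect to $(d-1)$-dimensional Lebesgue measure on the hyperplane, and the principal value is taken around the point $v$. For every $M_0,E_0$ there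 is a constant $c_s>0$, depending only on $d$, $s$, $M_0$, $E_0$ and the fixed collision kernel (that is, $\gamma$ and $b$), such that the following holds for every $T_0\in(0,1)$ and every flat torus $\mathbb T^d=(\mathbb R/L\mathbb Z)^d$, $L>0$. Let $f:[0,T_0]\times\mathbb T^d\times\mathbb R^d\to[0,\infty)$ be continuous, differentiable in $t$ (one-sidedly at $t=0$ and $t=T_0$) and in $x$, and twice differentiable in $v$, and suppose that at every point of $[0,T_0]\times\mathbb T^d\times\mathbb R^d$ the quantity $Q_s(f,f)$ is well defined (the integrand is integrable away from $v$ and the principal value exists) and $$\partial_t f+v\cdot\nabla_x f\ \ge\ Q_s(f,f).$$ Assume that for all $t\in[0,T_0]$ and $x\in\mathbb T^d$, $$\int_{\mathbb R^d}f(t,x,v)\,dv\le M_0,\qquad \int_{\mathbb R^d}f(t,x,v)\,|v|^2\,dv\le E_0,$$ and that for some $\ell>0$ and $R\ge1$ one has $f(t,x,v)\ge\ell$ for all $t\in[0,T_0]$, $x\in\mathbb T^d$, $v\in B_R$, where $B_\rho$ is the open ball of radius $\rho$ centred at $0$. Then for every $\xi\in(0,1-2^{-1/2})$ with $\xi^{q}R^{d+\gamma}\ell<1/2$,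 where $q=d+2(\gamma+2s+1)$, one has $$f(t,x,v)\ \ge\ c_s\,\xi^{q}R^{d+\gamma}\,\ell^{2}\,\min\!\big(t,\,R^{-\gamma}\xi^{2s}\big)\qquad\text{for all }t\in[0,T_0],\ x\in\mathbb T^d,\ v\in B_{\sqrt2(1-\xi)R}.$$ -/

import Mathlib

open Set Filter Topology MeasureTheory
open scoped ContDiff

noncomputable section

namespace Boltzmann

/-- The space `ℝᵈ` of positions or velocities, with its Euclidean norm. -/
abbrev Vec (d : ℕ) : Type := EuclideanSpace ℝ (Fin d)

/-- Non-cutoff angular kernel `b`, seen as a function of `cos θ`: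
`2 ^ (d - 1) b (cos θ) = |v - v'| ^ (-(d-1)-2s) |v - v⋆| ^ ((d-2)-γ) |v - v'⋆| ^ (γ+2s+1) b̃`
where `b̃`, as a function of the deviation angle `θ`, is smooth on `[0, π]` and strictly positive
on `[0, π)`. Here `|v - v'| = |v - v⋆| sin (θ/2)` and `|v - v'⋆| = |v - v⋆| cos (θ/2)`, and the
powers of `|v - v⋆|` cancel once the factor `|v - v⋆| ^ γ` of the collision kernel is split off. In
particular `b (cos θ)` is comparable to `θ ^ (-(d-1)-2s)` as `θ → 0`. -/
def IsNonCutoffKernel (d : ℕ) (γ s : ℝ) (b : ℝ → ℝ) : Prop :=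
  ∃ bt : ℝ → ℝ, ContDiffOn ℝ ∞ bt (Icc 0 Real.pi) ∧ (∀ θ ∈ Ico 0 Real.pi, 0 < bt θ) ∧
    ∀ θ ∈ Ioo 0 Real.pi,
      (2 : ℝ) ^ ((d : ℝ) - 1) * b (Real.cos θ) =
        Real.sin (θ / 2) ^ (-((d : ℝ) - 1) - 2 * s) * Real.cos (θ / 2) ^ (γ + 2 * s + 1) * bt θ

/-- The collision kernel `B (r, cos θ) = r ^ γ b (cos θ)`. -/
def collisionKernel (γ : ℝ) (b : ℝ → ℝ) (r c : ℝ) : ℝ := r ^ γ * b c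

/-- The cosine of the deviation angle, `cos θ = (v - v⋆)/|v - v⋆| · σ`, in terms of the four
velocities of a collision, where `σ = (v' - v'⋆)/|v' - v'⋆|`. -/
def cosDeviation {d : ℕ} (v vs v' vs' : Vec d) : ℝ :=
  inner ℝ (‖v - vs‖⁻¹ • (v - vs)) (‖v' - vs'‖⁻¹ • (v' - vs'))

/-- The Carleman kernel
`K_g (v, v') = 2 ^ (d-1) / |v' - v| ∫ g (v'⋆) |v - v⋆| ^ (-(d-2)) B (|v - v⋆|, cos θ) dv'⋆`,
the integral being over the hyperplane `v + (v' - v)^⊥` with its `(d-1)`-dimensional Lebesgue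
measure (so `v'⋆ = v + z` with `z` in the orthogonal complement of `v' - v`), and
`v⋆ = v' + v'⋆ - v` by conservation of momentum. -/
def carlemanKernel {d : ℕ} (γ : ℝ) (b : ℝ → ℝ) (g : Vec d → ℝ) (v v' : Vec d) : ℝ :=
  (2 : ℝ) ^ ((d : ℝ) - 1) / ‖v' - v‖ *
    ∫ z : (Submodule.span ℝ {v' - v})ᗮ,
      let vs' : Vec d := v + (z : Vec d)
      let vs : Vec d := v' + vs' - v
      g vs' * ‖v - vs‖ ^ (-((d : ℝ) - 2)) *
        collisionKernel γ b ‖v - vs‖ (cosDeviation v vs v' vs')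

/-- `q` is the Cauchy principal value of `∫ F (v') dv'` around the point `v`: `F` is integrable
away from `v`, and the truncated integrals converge to `q`. -/
def HasPrincipalValue {d : ℕ} (F : Vec d → ℝ) (v : Vec d) (q : ℝ) : Prop :=
  (∀ ε > 0, IntegrableOn F (Metric.ball v ε)ᶜ) ∧
    Tendsto (fun ε : ℝ => ∫ v' in (Metric.ball v ε)ᶜ, F v') (𝓝[>] 0) (𝓝 q)

/-- The singular part of the collision operator is well defined at `v` with value `q`:
`Q_s (g, h) (v) = p.v. ∫ K_g (v, v') (h (v') - h (v)) dv' = q`. -/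
def HasSingularPart {d : ℕ} (γ : ℝ) (b : ℝ → ℝ) (g h : Vec d → ℝ) (v : Vec d) (q : ℝ) : Prop :=
  HasPrincipalValue (fun v' => carlemanKernel γ b g v v' * (h v' - h v)) v q

/-- A nonnegative classical supersolution of `∂ₜ f + v · ∇ₓ f ≥ Q_s (f, f)` on
`[0, T] × 𝕋ᵈ × ℝᵈ`, where `𝕋ᵈ = (ℝ / L ℤ)ᵈ`; functions on the torus are periodic functions
on `ℝᵈ`. The time derivative is one-sided at `t = 0` and at `t = T`. -/
structure IsSupersolution {d : ℕ} (γ : ℝ) (b : ℝ → ℝ) (L T : ℝ)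
    (f : ℝ → Vec d → Vec d → ℝ) : Prop where
  periodic : ∀ t ∈ Icc 0 T, ∀ x v, ∀ i : Fin d,
    f t (x + EuclideanSpace.single i L) v = f t x v
  nonneg : ∀ t ∈ Icc 0 T, ∀ x v, 0 ≤ f t x v
  continuousOn : ContinuousOn (fun p : ℝ × Vec d × Vec d => f p.1 p.2.1 p.2.2)
    (Icc 0 T ×ˢ univ)
  differentiable_t : ∀ x v, DifferentiableOn ℝ (fun t => f t x v) (Icc 0 T)
  differentiable_x : ∀ t ∈ Icc 0 T, ∀ v, Differentiable ℝ (fun x => f t x v)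
  differentiable_v : ∀ t ∈ Icc 0 T, ∀ x, Differentiable ℝ (fun v => f t x v)
  twice_differentiable_v : ∀ t ∈ Icc 0 T, ∀ x,
    Differentiable ℝ (fun v => fderiv ℝ (fun w => f t x w) v)
  supersolution : ∀ t ∈ Icc 0 T, ∀ x v, ∃ q : ℝ,
    HasSingularPart γ b (f t x) (f t x) v q ∧
      q ≤ derivWithin (fun τ => f τ x v) (Icc 0 T) t + fderiv ℝ (fun y => f t y v) x v

/-- Mass density at most `M₀` and energy density at most `E₀`, at all times in `[0, T]` and
at all positions. -/
def HydrodynamicBounds {d : ℕ} (M₀ E₀ T : ℝ) (f : ℝ → Vec d → Vec d → ℝ) : Prop :=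
  ∀ t ∈ Icc 0 T, ∀ x,
    (Integrable (fun v => f t x v) ∧ ∫ v, f t x v ≤ M₀) ∧
    (Integrable (fun v => f t x v * ‖v‖ ^ 2) ∧ ∫ v, f t x v * ‖v‖ ^ 2 ≤ E₀)

end Boltzmann

end

namespace Boltzmann

open scoped ENNReal RealInnerProductSpace

/-! The proof is a barrier argument. Compare `f` with `lam(t) φ(v)`, where `φ` is a bump equal to 1
on `B_ρ`, `ρ = √2(1-ξ)R`, and vanishing for `|v| ≥ ρ + δ = √2(1-ξ/2)R`, and `lam` solves `lam' = A -
Λ lam`, `lam(0) = 0`. If `f < lam` somewhere on the inner ball, then `f - lam φ` attains a negative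
global minimum, by periodicity in `x` and compact support of `φ`. There `t > 0`, `∇ₓf = 0` and `∂ₜf
≤ lam' φ`, so `Q_s(f,f) ≤ lam' φ ≤ A - Λ lam` (`IsSupersolution.exists_contact`). A lower bound of
`Q_s` contradicts this.

For that bound, write the increment of `f` as the increment of `f - lam φ` plus `lam` times the
increment of `φ` (`truncated_integral_ge`).

Gain: the first increment is nonnegative by minimality, and at least `l/2` when `v'` lies in `B_R`,
because `lam ≤ l/2`. The contact velocity has `R ≤ |v| < √2(1-ξ/2)R`. For `w = v' - v` pointing
backwards at an angle near `π/4` to the line of `v`, both `v + w` and the projection of `v` on `ℝ w`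
lie in `B_R`. Hence `f ≥ l` on a ball of radius `ξR/8` in the hyperplane defining `K_f`. The kernel
is then at least of order `l ξ^(d-1) R^γ` on a set of such `w` of volume of order `ξ² R^d`, and the
gain is of order `l² ξ^(d+1) R^(d+γ)` (`le_setIntegral_reducedKernel`).

Loss: `K` is even in `w` and `φ` is semiconvex, so the second term is at least `-lam ∫ K
min((|w|/δ)^(1+s), 1)`. Carleman's change of variables `dw dz|_{w^⊥} / |w| = dz dw|_{z^⊥} / |z|`
bounds this integral by `δ^(-2s)` times the moment of order `γ + 2s ∈ [0,2]` of `f` about `v`, which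
mass and energy control (`lintegral_reducedKernel_mul_le`). With `δ` of order `ξR` this is of order
`ξ^(-2s) R^γ`, which fixes `Λ`. Finally `lam ≥ (A/2) min(t, 1/Λ)`. -/

theorem inner_of_mem_orthogonal_span {E : Type*} [NormedAddCommGroup E] [InnerProductSpace ℝ E]
    {w z : E} (hz : z ∈ (ℝ ∙ w)ᗮ) : ⟪w, z⟫ = 0 :=
  Submodule.mem_orthogonal_singleton_iff_inner_right.1 hz

theorem mem_orthogonal_span_of_inner {E : Type*} [NormedAddCommGroup E] [InnerProductSpace ℝ E]
    {w z : E} (hz : ⟪w, z⟫ = 0) : z ∈ (ℝ ∙ w)ᗮ :=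
  Submodule.mem_orthogonal_singleton_iff_inner_right.2 hz

/-! ### Hyperplane integrals, thin slabs and Carleman's change of variables -/

section Geometry

variable {E : Type*} [NormedAddCommGroup E] [InnerProductSpace ℝ E] [FiniteDimensional ℝ E]
  [MeasurableSpace E] [BorelSpace E]

/-- The equation `K = ℝ ∙ e` is a hypothesis so that `K` can be the span of an unnormalised vector.
-/
theorem measurePreserving_smul_add_orthogonal {e : E} (he : ‖e‖ = 1) {K : Submodule ℝ E}
    (hK : K = ℝ ∙ e) :
    MeasurePreserving (fun p : ℝ × Kᗮ => p.1 • e + (p.2 : E)) := by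
  subst hK
  have h1 := (LinearIsometryEquiv.toSpanUnitSingleton e he).measurePreserving.prod
    (MeasurePreserving.id (volume : Measure (ℝ ∙ e)ᗮ))
  have h2 := WithLp.volume_preserving_toLp (ℝ ∙ e) (ℝ ∙ e)ᗮ
  have h3 := (ℝ ∙ e).orthogonalDecomposition.symm.measurePreserving
  have h := h3.comp (h2.comp h1)
  convert! h using 1

theorem lintegral_eq_lintegral_orthogonal {w : E} (hw : w ≠ 0) {H : E → ℝ≥0∞}
    (hH : Measurable H) :
    ∫⁻ x, H x = ∫⁻ t : ℝ, ∫⁻ y : (ℝ ∙ w)ᗮ, H (t • (‖w‖⁻¹ • w) + (y : E)) := by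
  have he : ‖‖w‖⁻¹ • w‖ = 1 := by simp [norm_smul, hw]
  have hK : (ℝ ∙ w) = ℝ ∙ (‖w‖⁻¹ • w) :=
    (Submodule.span_singleton_smul_eq (by simp [hw]) w).symm
  have h := measurePreserving_smul_add_orthogonal he hK
  rw [← h.lintegral_comp hH]
  rw [Measure.volume_eq_prod, lintegral_prod]
  exact (hH.comp h.measurable).aemeasurable

/-- Lower semicontinuity of integrals over parallel hyperplanes. -/
theorem eventually_lt_lintegral_orthogonal {w e : E} {G : E → ℝ≥0∞} (hG : Continuous G) {c : ℝ≥0∞}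
    (hc : c < ∫⁻ y : (ℝ ∙ w)ᗮ, G y) :
    ∀ᶠ t : ℝ in 𝓝 0, c < ∫⁻ y : (ℝ ∙ w)ᗮ, G (t • e + (y : E)) := by
  have hF := lintegral_liminf_le (μ := (volume : Measure (ℝ ∙ w)ᗮ)) (u := 𝓝 (0 : ℝ))
    (f := fun t (y : (ℝ ∙ w)ᗮ) => G (t • e + (y : E)))
    (fun t => (hG.comp (by fun_prop)).measurable)
  have hlim : ∀ y : (ℝ ∙ w)ᗮ, liminf (fun t : ℝ => G (t • e + (y : E))) (𝓝 0) = G y := by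
    intro y
    have : Continuous fun t : ℝ => G (t • e + (y : E)) := hG.comp (by fun_prop)
    simpa using (this.tendsto 0).liminf_eq
  simp only [hlim] at hF
  exact eventually_lt_of_lt_liminf (hc.trans_le hF)

/-- The half-width of the slab is `η / ‖w‖`, not `η`: this is the source of the factor `1/|w|` in
Carleman's formula. -/
theorem setLIntegral_slab_eq {w : E} (hw : w ≠ 0) {G : E → ℝ≥0∞}
    (hG : Measurable G) (η : ℝ) :
    ∫⁻ z in {z : E | |⟪w, z⟫| < η}, G z =
      ∫⁻ t in {t : ℝ | |t| < η / ‖w‖}, ∫⁻ y : (ℝ ∙ w)ᗮ, G (t • (‖w‖⁻¹ • w) + (y : E)) := by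
  have hw' : 0 < ‖w‖ := norm_pos_iff.2 hw
  have hS : MeasurableSet {z : E | |⟪w, z⟫| < η} :=
    (isOpen_lt (by fun_prop) continuous_const).measurableSet
  have hT : MeasurableSet {t : ℝ | |t| < η / ‖w‖} :=
    (isOpen_lt (by fun_prop) continuous_const).measurableSet
  rw [← lintegral_indicator hS, lintegral_eq_lintegral_orthogonal hw (hG.indicator hS),
    ← lintegral_indicator hT]
  refine lintegral_congr fun t => ?_
  have key : ∀ y : (ℝ ∙ w)ᗮ, ⟪w, t • (‖w‖⁻¹ • w) + (y : E)⟫ = t * ‖w‖ := by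
    intro y
    rw [inner_add_right, inner_of_mem_orthogonal_span y.2, inner_smul_right, inner_smul_right,
      real_inner_self_eq_norm_sq]
    field_simp
    simp
  by_cases ht : |t| < η / ‖w‖
  · rw [indicator_of_mem (show t ∈ {t : ℝ | |t| < η / ‖w‖} from ht)]
    refine lintegral_congr fun y => indicator_of_mem ?_ _
    rw [mem_ofPred_eq, key, abs_mul, abs_of_pos hw']
    exact (lt_div_iff₀ hw').1 ht
  · rw [indicator_of_notMem (show t ∉ {t : ℝ | |t| < η / ‖w‖} from ht)]
    refine (lintegral_congr fun y => indicator_of_notMem ?_ _).trans lintegral_zero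
    rw [mem_ofPred_eq, key, abs_mul, abs_of_pos hw', ← lt_div_iff₀ hw']
    exact ht

theorem volume_abs_lt (r : ℝ) : volume {t : ℝ | |t| < r} = ENNReal.ofReal (2 * r) := by
  have : {t : ℝ | |t| < r} = Ioo (-r) r := by ext; simp [abs_lt]
  rw [this, Real.volume_Ioo]; ring_nf

/-- The integral over a hyperplane is bounded by averages over thin slabs. -/
theorem lintegral_orthogonal_le_liminf {w : E} (hw : w ≠ 0) {G : E → ℝ≥0∞} (hG : Continuous G) :
    ENNReal.ofReal ‖w‖⁻¹ * ∫⁻ z : (ℝ ∙ w)ᗮ, G z ≤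
      liminf (fun n : ℕ => ENNReal.ofReal (((n : ℝ) + 1) / 2) *
        ∫⁻ z in {z : E | |⟪w, z⟫| < 1 / ((n : ℝ) + 1)}, G z) atTop := by
  have hw' : 0 < ‖w‖ := norm_pos_iff.2 hw
  rw [mul_comm]
  refine ENNReal.mul_le_of_forall_lt fun c hc r hr => ?_
  refine le_liminf_of_le (by isBoundedDefault) ?_
  have h1 := eventually_lt_lintegral_orthogonal (e := ‖w‖⁻¹ • w) hG hc
  obtain ⟨δ, hδ, h2⟩ := Metric.eventually_nhds_iff.1 h1
  have h3 : Tendsto (fun n : ℕ => 1 / ((n : ℝ) + 1) / ‖w‖) atTop (𝓝 0) := by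
    simpa using tendsto_one_div_add_atTop_nhds_zero_nat.div_const ‖w‖
  filter_upwards [h3.eventually_lt_const hδ] with n hn
  rw [setLIntegral_slab_eq hw hG.measurable]
  have hT : MeasurableSet {t : ℝ | |t| < 1 / ((n : ℝ) + 1) / ‖w‖} :=
    (isOpen_lt (by fun_prop) continuous_const).measurableSet
  calc c * r ≤ c * ENNReal.ofReal ‖w‖⁻¹ := by gcongr
    _ = ENNReal.ofReal (((n : ℝ) + 1) / 2) *
        ∫⁻ t in {t : ℝ | |t| < 1 / ((n : ℝ) + 1) / ‖w‖}, c := by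
      rw [setLIntegral_const, volume_abs_lt, mul_left_comm, ← ENNReal.ofReal_mul (by positivity)]
      congr 2
      field_simp
    _ ≤ _ := by
      gcongr 1
      refine setLIntegral_mono_ae' hT (Eventually.of_forall fun t ht => (h2 ?_).le)
      rw [Real.dist_eq, sub_zero]
      exact lt_trans ht hn

theorem ae_ne_zero_orthogonal (hE : 2 ≤ Module.finrank ℝ E) (w : E) :
    ∀ᵐ y : (ℝ ∙ w)ᗮ, y ≠ 0 := by
  have h1 : Module.finrank ℝ (ℝ ∙ w) ≤ 1 :=
    (finrank_span_le_card ({w} : Set E)).trans (by simp)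
  have h2 := (ℝ ∙ w).finrank_add_finrank_orthogonal
  have : Nontrivial (ℝ ∙ w)ᗮ := Module.nontrivial_of_finrank_pos (R := ℝ) (by omega)
  exact measure_eq_zero_iff_ae_notMem.1 (measure_singleton (0 : (ℝ ∙ w)ᗮ))

/-- A weight decreasing in the norm has bounded averages over slabs. -/
theorem setLIntegral_slab_radial_le (hE : 2 ≤ Module.finrank ℝ E) {m : ℝ → ℝ≥0∞} (hm : Measurable m)
    (hanti : ∀ r r', 0 < r → r ≤ r' → m r' ≤ m r) {z : E} (hz : z ≠ 0) (η : ℝ) :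
    ∫⁻ w in {w : E | |⟪z, w⟫| < η}, m ‖w‖ ≤
      ENNReal.ofReal (2 * η) * (ENNReal.ofReal ‖z‖⁻¹ * ∫⁻ y : (ℝ ∙ z)ᗮ, m ‖y‖) := by
  rw [setLIntegral_slab_eq hz (G := fun w => m ‖w‖) (hm.comp measurable_norm)]
  calc _ ≤ ∫⁻ t in {t : ℝ | |t| < η / ‖z‖}, ∫⁻ y : (ℝ ∙ z)ᗮ, m ‖y‖ := by
        -- Leaving the hyperplane `z^⊥` orthogonally increases the norm, so the central slice of the
        -- slab carries the largest integral. The point `y = 0` is discarded because `hanti`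
        -- requires a positive radius.
        refine lintegral_mono fun t => lintegral_mono_ae ?_
        filter_upwards [ae_ne_zero_orthogonal hE z] with y hy
        refine hanti _ _ (norm_pos_iff.2 hy) ?_
        have h := norm_add_sq_real (t • (‖z‖⁻¹ • z)) (y : E)
        rw [inner_smul_left, inner_smul_left, inner_of_mem_orthogonal_span y.2] at h
        refine le_of_sq_le_sq ?_ (norm_nonneg _)
        simp only [mul_zero, add_zero] at h
        rw [h, Submodule.coe_norm]
        exact le_add_of_nonneg_left (sq_nonneg _)
    _ = _ := by
      rw [setLIntegral_const, volume_abs_lt, mul_comm, ← mul_assoc,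
        ← ENNReal.ofReal_mul' (by positivity)]
      congr 2
      ring

/-- One half of Carleman's change of variables for radial weights, with a measurable majorant of
the inner integral. -/
theorem exists_majorant_lintegral_orthogonal (hE : 2 ≤ Module.finrank ℝ E) {m : ℝ → ℝ≥0∞}
    (hm : Measurable m) (hanti : ∀ r r', 0 < r → r ≤ r' → m r' ≤ m r) (hfin : ∀ r, m r ≠ ⊤)
    {C : ℝ≥0∞} (hC : ∀ z : E, z ≠ 0 → ∫⁻ y : (ℝ ∙ z)ᗮ, m ‖y‖ ≤ C) {G : E → ℝ≥0∞}
    (hG : Continuous G) :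
    ∃ Φ : E → ℝ≥0∞, Measurable Φ ∧
      (∀ w : E, w ≠ 0 → ENNReal.ofReal ‖w‖⁻¹ * ∫⁻ z : (ℝ ∙ w)ᗮ, G z ≤ Φ w) ∧
      ∫⁻ w, m ‖w‖ * Φ w ≤ C * ∫⁻ z, ENNReal.ofReal ‖z‖⁻¹ * G z := by
  have hmn : Measurable fun w : E => m ‖w‖ := hm.comp measurable_norm
  have : Nontrivial E := Module.nontrivial_of_finrank_pos (R := ℝ) (by omega)
  have hS : ∀ η : ℝ, MeasurableSet {p : E × E | |⟪p.1, p.2⟫| < η} := fun η =>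
    (isOpen_lt (by fun_prop) continuous_const).measurableSet
  have hslice : ∀ (η : ℝ) (F : E → ℝ≥0∞) (w : E), ∫⁻ z in {z : E | |⟪w, z⟫| < η}, F z =
      ∫⁻ z, {p : E × E | |⟪p.1, p.2⟫| < η}.indicator (fun p => F p.2) (w, z) := by
    intro η F w
    have h : MeasurableSet {z : E | |⟪w, z⟫| < η} := (hS η).preimage measurable_prodMk_left
    rw [← lintegral_indicator h]
    rfl
  have hF : ∀ (η : ℝ), Measurable fun p : E × E =>
      {p : E × E | |⟪p.1, p.2⟫| < η}.indicator (fun p => G p.2) p := fun η =>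
    (hG.measurable.comp measurable_snd).indicator (hS η)
  -- The slab condition `|⟪w, z⟫| < η` is symmetric in `w` and `z` and, divided by `2η`,
  -- approximates `δ(⟪w, z⟫)`. Tonelli is applied at fixed `η` and Fatou passes to the limit. The
  -- liminf serves as a majorant that is measurable by construction.
  set a : ℕ → E → ℝ≥0∞ := fun n w => ENNReal.ofReal (((n : ℝ) + 1) / 2) *
        ∫⁻ z in {z : E | |⟪w, z⟫| < 1 / ((n : ℝ) + 1)}, G z with ha
  have hmeas : ∀ n, Measurable (a n) := by
    intro n
    simp only [ha, hslice]
    exact (hF _).lintegral_prod_right'.const_mul _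
  refine ⟨fun w => liminf (fun n => a n w) atTop, Measurable.liminf hmeas,
    fun w hw => lintegral_orthogonal_le_liminf hw hG, ?_⟩
  have hswap : ∀ n, ∫⁻ w, m ‖w‖ * a n w ≤ C * ∫⁻ z, ENNReal.ofReal ‖z‖⁻¹ * G z := by
    intro n
    set c := ENNReal.ofReal (((n : ℝ) + 1) / 2) with hc
    set η := 1 / ((n : ℝ) + 1) with hη
    have h1 : ∀ w, m ‖w‖ * a n w = ∫⁻ z, c * (m ‖w‖ *
        {p : E × E | |⟪p.1, p.2⟫| < η}.indicator (fun p => G p.2) (w, z)) := by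
      intro w
      have h2 : Measurable fun z =>
          {p : E × E | |⟪p.1, p.2⟫| < η}.indicator (fun p => G p.2) (w, z) :=
        (hF η).comp measurable_prodMk_left
      rw [lintegral_const_mul _ (h2.const_mul _), lintegral_const_mul _ h2, ← hslice,
        mul_left_comm]
    simp only [h1]
    rw [lintegral_lintegral_swap (((hmn.comp measurable_fst).mul (hF η)).const_mul c).aemeasurable,
      ← lintegral_const_mul _ (by
        exact (measurable_norm.inv.ennreal_ofReal).mul hG.measurable)]
    refine lintegral_mono_ae ?_
    have hz0 : ∀ᵐ z : E, z ≠ 0 := measure_eq_zero_iff_ae_notMem.1 (measure_singleton (0 : E))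
    filter_upwards [hz0] with z hz
    have h3 : ∀ w, c * (m ‖w‖ *
        {p : E × E | |⟪p.1, p.2⟫| < η}.indicator (fun p => G p.2) (w, z)) =
        (c * G z) * {w : E | |⟪z, w⟫| < η}.indicator (fun w => m ‖w‖) w := by
      intro w
      by_cases h : |⟪w, z⟫| < η
      · rw [indicator_of_mem (show (w, z) ∈ {p : E × E | |⟪p.1, p.2⟫| < η} from h),
          indicator_of_mem (show w ∈ {w : E | |⟪z, w⟫| < η} by
            rwa [mem_ofPred_eq, real_inner_comm])]
        ring
      · rw [indicator_of_notMem (show (w, z) ∉ {p : E × E | |⟪p.1, p.2⟫| < η} from h),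
          indicator_of_notMem (show w ∉ {w : E | |⟪z, w⟫| < η} by
            rwa [mem_ofPred_eq, real_inner_comm])]
        simp
    have hSz : MeasurableSet {w : E | |⟪z, w⟫| < η} :=
      (isOpen_lt (by fun_prop) continuous_const).measurableSet
    simp only [h3]
    rw [lintegral_const_mul _ (hmn.indicator hSz), lintegral_indicator hSz]
    calc _ ≤ c * G z * (ENNReal.ofReal (2 * η) * (ENNReal.ofReal ‖z‖⁻¹ * C)) := by
          gcongr
          refine (setLIntegral_slab_radial_le hE hm hanti hz η).trans ?_
          gcongr
          exact hC z hz
      _ = (c * ENNReal.ofReal (2 * η)) * (C * (ENNReal.ofReal ‖z‖⁻¹ * G z)) := by ring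
      _ = _ := by
        rw [hc, hη, ← ENNReal.ofReal_mul (by positivity)]
        have : ((n : ℝ) + 1) / 2 * (2 * (1 / ((n : ℝ) + 1))) = 1 := by field_simp
        rw [this, ENNReal.ofReal_one, one_mul]
  calc ∫⁻ w, m ‖w‖ * liminf (fun n => a n w) atTop
      = ∫⁻ w, liminf (fun n => m ‖w‖ * a n w) atTop :=
        lintegral_congr fun w => (ENNReal.liminf_const_mul_of_ne_top (hfin _)).symm
    _ ≤ liminf (fun n => ∫⁻ w, m ‖w‖ * a n w) atTop :=
        lintegral_liminf_le fun n => hmn.mul (hmeas n)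
    _ ≤ liminf (fun _ : ℕ => C * ∫⁻ z, ENNReal.ofReal ‖z‖⁻¹ * G z) atTop :=
        liminf_le_liminf (Eventually.of_forall hswap)
    _ = _ := by simp

end Geometry

/-! ### The radial weight and its integral -/

/-- The volume of the unit ball of `ℝⁿ`. -/
noncomputable def unitBallVolume (n : ℕ) : ℝ := √Real.pi ^ n / Real.Gamma (n / 2 + 1)

theorem unitBallVolume_pos (n : ℕ) : 0 < unitBallVolume n := by
  have := Real.Gamma_pos_of_pos (s := (n : ℝ) / 2 + 1) (by positivity)
  unfold unitBallVolume
  positivity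

/-- The radial weight `r ^ (-n-2s) min ((r/δ) ^ (1+s), 1)`. -/
noncomputable def tailWeight (n : ℕ) (s δ r : ℝ) : ℝ :=
  r ^ (-(n : ℝ) - 2 * s) * min ((r / δ) ^ (1 + s)) 1

theorem tailWeight_nonneg {n : ℕ} {s δ r : ℝ} (hδ : 0 < δ) (hr : 0 ≤ r) :
    0 ≤ tailWeight n s δ r := by
  unfold tailWeight
  have : 0 ≤ min ((r / δ) ^ (1 + s)) 1 := le_min (by positivity) zero_le_one
  positivity

theorem measurable_tailWeight (n : ℕ) (s δ : ℝ) : Measurable (tailWeight n s δ) := by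
  unfold tailWeight
  fun_prop

/-- Below `δ` the exponent is `1 - n - s ≤ 0`. This is why the cutoff power is `1 + s`: with the
power 2 suggested by second differences, monotonicity would fail for `n = 1` and `s < 1/2`. -/
theorem tailWeight_anti {n : ℕ} (hn : 1 ≤ n) {s δ r r' : ℝ} (hs : 0 < s) (hδ : 0 < δ) (hr : 0 < r)
    (hrr : r ≤ r') : tailWeight n s δ r' ≤ tailWeight n s δ r := by
  have hr' := hr.trans_le hrr
  have hn' : (1 : ℝ) ≤ n := by exact_mod_cast hn
  have key : ∀ x : ℝ, 0 < x → tailWeight n s δ x =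
      min (x ^ (-(n : ℝ) - 2 * s + (1 + s)) * (δ ^ (1 + s))⁻¹) (x ^ (-(n : ℝ) - 2 * s)) := by
    intro x hx
    unfold tailWeight
    rw [mul_min_of_nonneg _ _ (by positivity), mul_one, Real.div_rpow hx.le hδ.le,
      Real.rpow_add hx (-(n : ℝ) - 2 * s) (1 + s), div_eq_mul_inv, mul_assoc]
  rw [key _ hr', key _ hr]
  refine min_le_min ?_ ?_
  · exact mul_le_mul_of_nonneg_right (Real.rpow_le_rpow_of_nonpos hr hrr (by linarith))
      (by positivity)
  · exact Real.rpow_le_rpow_of_nonpos hr hrr (by linarith)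

theorem pow_mul_tailWeight_of_le {n : ℕ} (hn : 1 ≤ n) {s δ r : ℝ} (hs : 0 < s) (hr : 0 < r)
    (hrδ : r ≤ δ) : r ^ (n - 1) * tailWeight n s δ r = r ^ (-s) * (δ ^ (1 + s))⁻¹ := by
  have hδ : 0 < δ := hr.trans_le hrδ
  have h1 : min ((r / δ) ^ (1 + s)) 1 = (r / δ) ^ (1 + s) :=
    min_eq_left (Real.rpow_le_one (by positivity) ((div_le_one hδ).2 hrδ) (by linarith))
  rw [tailWeight, h1, Real.div_rpow hr.le hδ.le, ← Real.rpow_natCast, div_eq_mul_inv,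
    ← mul_assoc, ← mul_assoc, ← Real.rpow_add hr, ← Real.rpow_add hr]
  congr 2
  rw [Nat.cast_sub hn]
  push_cast
  ring

theorem pow_mul_tailWeight_of_lt {n : ℕ} (hn : 1 ≤ n) {s δ r : ℝ} (hs : 0 < s) (hδ : 0 < δ)
    (hrδ : δ < r) : r ^ (n - 1) * tailWeight n s δ r = r ^ (-1 - 2 * s) := by
  have hr : 0 < r := hδ.trans hrδ
  have h1 : min ((r / δ) ^ (1 + s)) 1 = 1 :=
    min_eq_right (Real.one_le_rpow ((one_le_div hδ).2 hrδ.le) (by linarith))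
  rw [tailWeight, h1, mul_one, ← Real.rpow_natCast, ← Real.rpow_add hr]
  congr 1
  rw [Nat.cast_sub hn]
  push_cast
  ring

/-- In polar coordinates the integrand is `r^(-s) δ^(-1-s)` up to `δ` and `r^(-1-2s)` beyond. Both
pieces converge for `0 < s < 1` and scale like `δ^(-2s)`. -/
theorem integrableOn_pow_mul_tailWeight {n : ℕ} (hn : 1 ≤ n) {s δ : ℝ} (hs : s ∈ Ioo (0 : ℝ) 1)
    (hδ : 0 < δ) :
    IntegrableOn (fun r => r ^ (n - 1) * tailWeight n s δ r) (Ioi 0) ∧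
      ∫ r in Ioi 0, r ^ (n - 1) * tailWeight n s δ r =
        (1 / (1 - s) + 1 / (2 * s)) * δ ^ (-(2 * s)) := by
  obtain ⟨hs0, hs1⟩ := hs
  have e1 : EqOn (fun r => r ^ (n - 1) * tailWeight n s δ r)
      (fun r => r ^ (-s) * (δ ^ (1 + s))⁻¹) (Ioc 0 δ) :=
    fun r hr => pow_mul_tailWeight_of_le hn hs0 hr.1 hr.2
  have e2 : EqOn (fun r => r ^ (n - 1) * tailWeight n s δ r) (fun r => r ^ (-1 - 2 * s)) (Ioi δ) :=
    fun r hr => pow_mul_tailWeight_of_lt hn hs0 hδ hr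
  have i1 : IntegrableOn (fun r => r ^ (n - 1) * tailWeight n s δ r) (Ioc 0 δ) := by
    rw [integrableOn_congr_fun e1 measurableSet_Ioc]
    exact ((intervalIntegrable_iff_integrableOn_Ioc_of_le hδ.le).1
      (intervalIntegral.intervalIntegrable_rpow' (by linarith))).mul_const _
  have i2 : IntegrableOn (fun r => r ^ (n - 1) * tailWeight n s δ r) (Ioi δ) := by
    rw [integrableOn_congr_fun e2 measurableSet_Ioi]
    exact integrableOn_Ioi_rpow_of_lt (by linarith) hδ
  rw [← Ioc_union_Ioi_eq_Ioi hδ.le]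
  refine ⟨i1.union i2, ?_⟩
  rw [setIntegral_union (Ioc_disjoint_Ioi le_rfl) measurableSet_Ioi i1 i2,
    setIntegral_congr_fun measurableSet_Ioc e1, setIntegral_congr_fun measurableSet_Ioi e2,
    integral_Ioi_rpow_of_lt (by linarith) hδ, integral_mul_const,
    ← intervalIntegral.integral_of_le hδ.le, integral_rpow (Or.inl (by linarith)),
    Real.zero_rpow (by linarith)]
  have h1 : δ ^ (-s + 1) * (δ ^ (1 + s))⁻¹ = δ ^ (-(2 * s)) := by
    rw [← Real.rpow_neg hδ.le, ← Real.rpow_add hδ]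
    ring_nf
  have h2 : δ ^ (-1 - 2 * s + 1) = δ ^ (-(2 * s)) := by ring_nf
  have h3 : 1 - s ≠ 0 := by linarith
  rw [h2, sub_zero, div_mul_eq_mul_div, h1]
  have h4 : (-s + 1) = 1 - s := by ring
  have h5 : -1 - 2 * s + 1 = -(2 * s) := by ring
  rw [h4, h5]
  field_simp

/-- The constant in the integral of the tail weight. -/
noncomputable def tailConst (n : ℕ) (s : ℝ) : ℝ :=
  n * unitBallVolume n * (1 / (1 - s) + 1 / (2 * s))

theorem tailConst_pos {n : ℕ} (hn : 1 ≤ n) {s : ℝ} (hs : s ∈ Ioo (0 : ℝ) 1) :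
    0 < tailConst n s := by
  have h1 : 0 < 1 - s := sub_pos.2 hs.2
  have h2 := hs.1
  have h3 := unitBallVolume_pos n
  have h4 : (0 : ℝ) < n := by exact_mod_cast hn
  unfold tailConst
  positivity

theorem finrank_orthogonal_span {E : Type*} [NormedAddCommGroup E] [InnerProductSpace ℝ E] {n : ℕ}
    (hE : Module.finrank ℝ E = n + 1) {w : E} (hw : w ≠ 0) :
    Module.finrank ℝ (ℝ ∙ w)ᗮ = n := by
  have : Fact (Module.finrank ℝ E = n + 1) := ⟨hE⟩
  exact Submodule.finrank_orthogonal_span_singleton hw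

section Geometry

variable {E : Type*} [NormedAddCommGroup E] [InnerProductSpace ℝ E] [FiniteDimensional ℝ E]
  [MeasurableSpace E] [BorelSpace E]

theorem volume_ball_of_finrank {n : ℕ} (hn : 1 ≤ n) (hE : Module.finrank ℝ E = n) (x : E) {r : ℝ}
    (hr : 0 ≤ r) : volume (Metric.ball x r) = ENNReal.ofReal (r ^ n * unitBallVolume n) := by
  have : Nontrivial E := Module.nontrivial_of_finrank_pos (R := ℝ) (by omega)
  rw [InnerProductSpace.volume_ball, hE, ENNReal.ofReal_mul (by positivity),
    ENNReal.ofReal_pow hr, unitBallVolume]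

theorem lintegral_tailWeight {n : ℕ} (hn : 1 ≤ n) (hE : Module.finrank ℝ E = n) {s δ : ℝ}
    (hs : s ∈ Ioo (0 : ℝ) 1) (hδ : 0 < δ) :
    ∫⁻ y : E, ENNReal.ofReal (tailWeight n s δ ‖y‖) =
      ENNReal.ofReal (tailConst n s * δ ^ (-(2 * s))) := by
  have : Nontrivial E := Module.nontrivial_of_finrank_pos (R := ℝ) (by omega)
  obtain ⟨h1, h2⟩ := integrableOn_pow_mul_tailWeight hn hs hδ
  have hi : Integrable (fun y : E => tailWeight n s δ ‖y‖) := by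
    rw [integrable_fun_norm_addHaar, hE]
    exact h1
  rw [← ofReal_integral_eq_lintegral_ofReal hi
    (Eventually.of_forall fun y => tailWeight_nonneg hδ (norm_nonneg y)),
    integral_fun_norm_addHaar, hE]
  simp only [smul_eq_mul, nsmul_eq_mul]
  rw [h2, Measure.real, volume_ball_of_finrank hn hE 0 zero_le_one, one_pow, one_mul,
    ENNReal.toReal_ofReal (unitBallVolume_pos n).le, tailConst]
  ring_nf

/-! ### Measurable dependence of hyperplane integrals on the normal -/

theorem integral_map_linearIsometryEquiv (A : E ≃ₗᵢ[ℝ] E) {K K' : Submodule ℝ E}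
    (hK : K.map (A.toLinearEquiv : E →ₗ[ℝ] E) = K') (F : E → ℝ) :
    ∫ z : K', F z = ∫ y : K, F (A y) := by
  subst hK
  have h := (A.submoduleMap K).measurePreserving
  exact (h.integral_comp (A.submoduleMap K).toHomeomorph.measurableEmbedding
    (fun z => F (z : E))).symm

/-- Hyperplane integrals depend measurably on the normal vector. -/
theorem exists_measurable_integral_orthogonal {e : E} (he : ‖e‖ = 1) {F : E → E → ℝ}
    (hF : Measurable (Function.uncurry F)) :
    ∃ g : E → ℝ, Measurable g ∧ ∀ w : E, w ≠ 0 → ∫ z : (ℝ ∙ w)ᗮ, F w z = g w := by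
  -- Explicit formula for the reflection exchanging `‖w‖ e` and `w`. It transports every hyperplane
  -- `w^⊥` to the fixed `e^⊥` and is jointly measurable. For `w = ‖w‖ e` the convention `0 / 0 = 0`
  -- gives the identity, as it should.
  set ρ : E → E → E := fun w y =>
    y - (2 * (⟪‖w‖ • e - w, y⟫ / ‖‖w‖ • e - w‖ ^ 2)) • (‖w‖ • e - w) with hρ
  have hρm : Measurable (Function.uncurry ρ) := by
    simp only [hρ, Function.uncurry_def]
    fun_prop
  refine ⟨fun w => ∫ y : (ℝ ∙ e)ᗮ, F w (ρ w y), ?_, ?_⟩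
  · have : Measurable fun p : E × (ℝ ∙ e)ᗮ => F p.1 (ρ p.1 p.2) :=
      hF.comp (measurable_fst.prodMk
        (hρm.comp (measurable_fst.prodMk (measurable_subtype_coe.comp measurable_snd))))
    exact (this.stronglyMeasurable.integral_prod_right').measurable
  · intro w hw
    have hw' : ‖w‖ ≠ 0 := norm_ne_zero_iff.2 hw
    set A := (ℝ ∙ (‖w‖ • e - w))ᗮ.reflection with hA
    have hAw : A (‖w‖ • e) = w := Submodule.reflection_sub (by simp [norm_smul, he])
    have hK : (ℝ ∙ e)ᗮ.map (A.toLinearEquiv : E →ₗ[ℝ] E) = (ℝ ∙ w)ᗮ := by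
      have h1 : (ℝ ∙ e) = ℝ ∙ (‖w‖ • e) :=
        (Submodule.span_singleton_smul_eq (by simp [hw]) e).symm
      have h2 := Submodule.map_orthogonal_equiv (ℝ ∙ e) A
      rw [h2, h1, Submodule.map_span]
      congr 2
      simpa using hAw
    rw [integral_map_linearIsometryEquiv A hK]
    refine integral_congr_ae (Eventually.of_forall fun y => ?_)
    simp only
    congr 1
    rw [hA, Submodule.reflection_orthogonal_apply, Submodule.reflection_singleton_apply]
    simp only [hρ, neg_sub, two_mul, add_smul, two_smul]
    rfl

end Geometry

/-! ### Angular profile and simplified Carleman kernel -/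

/-- A continuous bounded extension `β` to `ℝ` of the smooth factor `b̃` of a non-cutoff kernel. -/
structure IsAngularProfile (d : ℕ) (γ s : ℝ) (b β : ℝ → ℝ) (B : ℝ) : Prop where
  continuous : Continuous β
  nonneg : ∀ θ, 0 ≤ β θ
  le : ∀ θ, β θ ≤ B
  pos : ∀ θ ∈ Ico 0 Real.pi, 0 < β θ
  eq : ∀ θ ∈ Ioo 0 Real.pi, (2 : ℝ) ^ ((d : ℝ) - 1) * b (Real.cos θ) =
    Real.sin (θ / 2) ^ (-((d : ℝ) - 1) - 2 * s) * Real.cos (θ / 2) ^ (γ + 2 * s + 1) * β θ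

theorem IsNonCutoffKernel.exists_profile {d : ℕ} {γ s : ℝ} {b : ℝ → ℝ}
    (hb : IsNonCutoffKernel d γ s b) : ∃ β B, IsAngularProfile d γ s b β B := by
  obtain ⟨bt, hc, hpos, heq⟩ := hb
  have hπ : (0 : ℝ) ≤ Real.pi := Real.pi_pos.le
  have hcont : ContinuousOn bt (Icc 0 Real.pi) := hc.continuousOn
  obtain ⟨B, hB⟩ := isCompact_Icc.bddAbove_image hcont
  have hnn : ∀ θ ∈ Icc 0 Real.pi, 0 ≤ bt θ := by
    intro θ hθ
    have hθ' : θ ∈ closure (Ico 0 Real.pi) := by rwa [closure_Ico Real.pi_pos.ne]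
    exact ContinuousWithinAt.closure_le hθ' continuousWithinAt_const
      ((hcont θ hθ).mono Ico_subset_Icc_self) fun x hx => (hpos x hx).le
  refine ⟨IccExtend hπ ((Icc 0 Real.pi).domRestrict bt), B, ?_, ?_, ?_, ?_, ?_⟩
  · exact hcont.domRestrict.Icc_extend'
  · exact fun θ => hnn _ (projIcc 0 Real.pi hπ θ).2
  · exact fun θ => hB (mem_image_of_mem _ (projIcc 0 Real.pi hπ θ).2)
  · intro θ hθ
    rw [IccExtend_of_mem hπ _ (Ico_subset_Icc_self hθ)]
    exact hpos θ hθ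
  · intro θ hθ
    rw [IccExtend_of_mem hπ _ (Ioo_subset_Icc_self hθ)]
    exact heq θ hθ

/-- The deviation angle of a collision with `|v' - v| = r` and `|v'⋆ - v| = ρ`. -/
noncomputable def deviationAngle (r ρ : ℝ) : ℝ :=
  Real.arccos ((ρ ^ 2 - r ^ 2) / (ρ ^ 2 + r ^ 2))

theorem measurable_deviationAngle : Measurable (Function.uncurry deviationAngle) := by
  unfold deviationAngle Function.uncurry
  exact Real.continuous_arccos.measurable.comp (by fun_prop)

/-- Half the deviation angle is the angle opposite the leg `r` in the right triangle with legs `r`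
and `ρ`. -/
theorem deviationAngle_facts {r ρ : ℝ} (hr : 0 < r) (hρ : 0 < ρ) :
    deviationAngle r ρ ∈ Ioo 0 Real.pi ∧
    Real.cos (deviationAngle r ρ) = (ρ ^ 2 - r ^ 2) / (ρ ^ 2 + r ^ 2) ∧
    Real.sin (deviationAngle r ρ / 2) = r / √(ρ ^ 2 + r ^ 2) ∧
    Real.cos (deviationAngle r ρ / 2) = ρ / √(ρ ^ 2 + r ^ 2) := by
  set D := ρ ^ 2 + r ^ 2 with hD
  have hDpos : 0 < D := by positivity
  have h1 : -1 < (ρ ^ 2 - r ^ 2) / D := by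
    rw [lt_div_iff₀ hDpos]; nlinarith [sq_pos_of_pos hρ]
  have h2 : (ρ ^ 2 - r ^ 2) / D < 1 := by
    rw [div_lt_one hDpos]; nlinarith [sq_pos_of_pos hr]
  set θ := deviationAngle r ρ with hθ
  have hcos : Real.cos θ = (ρ ^ 2 - r ^ 2) / D := Real.cos_arccos h1.le h2.le
  have h3 : 0 < θ := Real.arccos_pos.2 h2
  have h4 : θ < Real.pi := by
    refine lt_of_le_of_ne (Real.arccos_le_pi _) fun h => ?_
    rw [h, Real.cos_pi] at hcos
    linarith
  have hsq : √D ^ 2 = D := Real.sq_sqrt hDpos.le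
  refine ⟨⟨h3, h4⟩, hcos, ?_, ?_⟩
  · have hs0 : 0 ≤ Real.sin (θ / 2) := Real.sin_nonneg_of_nonneg_of_le_pi (by linarith) (by linarith)
    rw [← sq_eq_sq₀ hs0 (by positivity), div_pow, hsq, Real.sin_sq_eq_half_sub,
      mul_div_cancel₀ θ two_ne_zero, hcos]
    field_simp
    rw [hD]; ring
  · have hs0 : 0 ≤ Real.cos (θ / 2) := Real.cos_nonneg_of_neg_pi_div_two_le_of_le
      (by linarith) (by linarith)
    rw [← sq_eq_sq₀ hs0 (by positivity), div_pow, hsq, Real.cos_sq,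
      mul_div_cancel₀ θ two_ne_zero, hcos]
    field_simp
    rw [hD]; ring

theorem norm_add_eq_of_inner_eq_zero {d : ℕ} {w z : Vec d} (h : ⟪w, z⟫ = 0) :
    ‖w + z‖ = √(‖z‖ ^ 2 + ‖w‖ ^ 2) := by
  rw [← Real.sqrt_sq (norm_nonneg (w + z)), norm_add_sq_real, h]
  ring_nf

theorem norm_sub_eq_of_inner_eq_zero {d : ℕ} {w z : Vec d} (h : ⟪w, z⟫ = 0) :
    ‖w - z‖ = √(‖z‖ ^ 2 + ‖w‖ ^ 2) := by
  rw [← Real.sqrt_sq (norm_nonneg (w - z)), norm_sub_sq_real, h]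
  ring_nf

/-- The Carleman kernel as a function of `w = v' - v`, after simplification of the powers. -/
noncomputable def reducedKernel {d : ℕ} (γ s : ℝ) (β : ℝ → ℝ) (g : Vec d → ℝ) (v w : Vec d) : ℝ :=
  ‖w‖ ^ (-(d : ℝ) - 2 * s) *
    ∫ z : (ℝ ∙ w)ᗮ, g (v + z) * ‖(z : Vec d)‖ ^ (γ + 2 * s + 1) *
      β (deviationAngle ‖w‖ ‖(z : Vec d)‖)

/-- The powers of `‖w + z‖` cancel: `-(d-2) + γ + (d-1+2s) - (γ+2s+1) = 0`. -/
theorem carlemanKernel_integrand_eq {d : ℕ} {γ s : ℝ} {b β : ℝ → ℝ} {B : ℝ}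
    (hβ : IsAngularProfile d γ s b β B) {w z : Vec d} (hw : w ≠ 0) (hz : z ≠ 0)
    (hwz : ⟪w, z⟫ = 0) :
    (2 : ℝ) ^ ((d : ℝ) - 1) / ‖w‖ * (‖w + z‖ ^ (-((d : ℝ) - 2)) *
      collisionKernel γ b ‖w + z‖ ((‖z‖ ^ 2 - ‖w‖ ^ 2) / (‖z‖ ^ 2 + ‖w‖ ^ 2))) =
    ‖w‖ ^ (-(d : ℝ) - 2 * s) * (‖z‖ ^ (γ + 2 * s + 1) * β (deviationAngle ‖w‖ ‖z‖)) := by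
  have hw' : 0 < ‖w‖ := norm_pos_iff.2 hw
  have hz' : 0 < ‖z‖ := norm_pos_iff.2 hz
  obtain ⟨h1, h2, h3, h4⟩ := deviationAngle_facts hw' hz'
  have h5 := hβ.eq _ h1
  rw [h2, h3, h4] at h5
  rw [norm_add_eq_of_inner_eq_zero hwz, collisionKernel]
  set D := √(‖z‖ ^ 2 + ‖w‖ ^ 2) with hD
  have hDpos : 0 < D := Real.sqrt_pos.2 (by positivity)
  have e1 : (2 : ℝ) ^ ((d : ℝ) - 1) / ‖w‖ * (D ^ (-((d : ℝ) - 2)) *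
      (D ^ γ * b ((‖z‖ ^ 2 - ‖w‖ ^ 2) / (‖z‖ ^ 2 + ‖w‖ ^ 2)))) =
      ‖w‖⁻¹ * D ^ (-((d : ℝ) - 2)) * D ^ γ * ((2 : ℝ) ^ ((d : ℝ) - 1) *
        b ((‖z‖ ^ 2 - ‖w‖ ^ 2) / (‖z‖ ^ 2 + ‖w‖ ^ 2))) := by ring
  rw [e1, h5, Real.div_rpow hw'.le hDpos.le, Real.div_rpow hz'.le hDpos.le, div_eq_mul_inv,
    div_eq_mul_inv, ← Real.rpow_neg hDpos.le, ← Real.rpow_neg hDpos.le,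
    ← Real.rpow_neg_one ‖w‖]
  have e2 : ‖w‖ ^ (-1 : ℝ) * ‖w‖ ^ (-((d : ℝ) - 1) - 2 * s) = ‖w‖ ^ (-(d : ℝ) - 2 * s) := by
    rw [← Real.rpow_add hw']; ring_nf
  have e3 : D ^ (-((d : ℝ) - 2)) * D ^ γ * D ^ (-(-((d : ℝ) - 1) - 2 * s)) *
      D ^ (-(γ + 2 * s + 1)) = 1 := by
    rw [← Real.rpow_add hDpos, ← Real.rpow_add hDpos, ← Real.rpow_add hDpos]
    ring_nf
    exact Real.rpow_zero D
  calc _ = (‖w‖ ^ (-1 : ℝ) * ‖w‖ ^ (-((d : ℝ) - 1) - 2 * s)) *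
        (‖z‖ ^ (γ + 2 * s + 1) * β (deviationAngle ‖w‖ ‖z‖)) *
        (D ^ (-((d : ℝ) - 2)) * D ^ γ * D ^ (-(-((d : ℝ) - 1) - 2 * s)) *
          D ^ (-(γ + 2 * s + 1))) := by ring
    _ = _ := by rw [e2, e3, mul_one]

theorem carlemanKernel_eq_reducedKernel {d : ℕ} (hd : 2 ≤ d) {γ s : ℝ} {b β : ℝ → ℝ} {B : ℝ}
    (hβ : IsAngularProfile d γ s b β B) (g : Vec d → ℝ) {v v' : Vec d} (hv : v' ≠ v) :
    carlemanKernel γ b g v v' = reducedKernel γ s β g v (v' - v) := by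
  have hw : v' - v ≠ 0 := sub_ne_zero.2 hv
  unfold carlemanKernel reducedKernel
  rw [← integral_const_mul, ← integral_const_mul]
  refine integral_congr_ae ?_
  have hE : 2 ≤ Module.finrank ℝ (Vec d) := by simpa using hd
  -- At `z = 0` the deviation angle is `π`, where the formula for `b` is not assumed. This is a null
  -- set since `d ≥ 2`.
  filter_upwards [ae_ne_zero_orthogonal hE (v' - v)] with z hz
  have hz0 : (z : Vec d) ≠ 0 := by simpa using hz
  have hwz : ⟪v' - v, (z : Vec d)⟫ = 0 := inner_of_mem_orthogonal_span z.2
  have h := carlemanKernel_integrand_eq hβ hw hz0 hwz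
  have e1 : v - (v' + (v + (z : Vec d)) - v) = -((v' - v) + z) := by abel
  have e2 : v' - (v + (z : Vec d)) = (v' - v) - z := by abel
  have e3 : cosDeviation v (v' + (v + (z : Vec d)) - v) v' (v + z) =
      (‖(z : Vec d)‖ ^ 2 - ‖v' - v‖ ^ 2) / (‖(z : Vec d)‖ ^ 2 + ‖v' - v‖ ^ 2) := by
    unfold cosDeviation
    rw [e1, e2, norm_neg, real_inner_smul_left, real_inner_smul_right, inner_neg_left,
      norm_add_eq_of_inner_eq_zero hwz, norm_sub_eq_of_inner_eq_zero hwz, inner_add_left,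
      inner_sub_right (v' - v), inner_sub_right (z : Vec d), hwz, real_inner_comm (v' - v) (z : Vec d),
      hwz, real_inner_self_eq_norm_sq, real_inner_self_eq_norm_sq, ← mul_assoc, ← mul_inv,
      Real.mul_self_sqrt (by positivity)]
    ring
  simp only [e3, e1, norm_neg]
  calc _ = g (v + z) * ((2 : ℝ) ^ ((d : ℝ) - 1) / ‖v' - v‖ *
      (‖(v' - v) + (z : Vec d)‖ ^ (-((d : ℝ) - 2)) * collisionKernel γ b ‖(v' - v) + (z : Vec d)‖
      ((‖(z : Vec d)‖ ^ 2 - ‖v' - v‖ ^ 2) / (‖(z : Vec d)‖ ^ 2 + ‖v' - v‖ ^ 2)))) := by ring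
    _ = _ := by rw [h]; ring

theorem reducedKernel_nonneg {d : ℕ} {γ s : ℝ} {β : ℝ → ℝ} (hβ : ∀ θ, 0 ≤ β θ) {g : Vec d → ℝ}
    (hg : ∀ v, 0 ≤ g v) (v w : Vec d) : 0 ≤ reducedKernel γ s β g v w := by
  unfold reducedKernel
  refine mul_nonneg (by positivity) (integral_nonneg fun z => ?_)
  exact mul_nonneg (mul_nonneg (hg _) (by positivity)) (hβ _)

/-- The kernel depends on `w` only through `‖w‖` and `w^⊥`. This evenness turns first differences of
the bump into second differences. -/
theorem reducedKernel_neg {d : ℕ} {γ s : ℝ} {β : ℝ → ℝ} (g : Vec d → ℝ) (v w : Vec d) :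
    reducedKernel γ s β g v (-w) = reducedKernel γ s β g v w := by
  have h : (ℝ ∙ (-w)) = ℝ ∙ w := by
    rw [← Submodule.span_neg {w}, Set.neg_singleton]
  have aux : ∀ (K K' : Submodule ℝ (Vec d)) (F : Vec d → ℝ), K = K' →
      ∫ z : Kᗮ, F z = ∫ z : K'ᗮ, F z := by
    rintro K _ F rfl
    rfl
  unfold reducedKernel
  rw [norm_neg, aux _ _ (fun z => g (v + z) * ‖z‖ ^ (γ + 2 * s + 1) *
      β (deviationAngle ‖w‖ ‖z‖)) h]

theorem exists_measurable_eq_reducedKernel {d : ℕ} (hd : 2 ≤ d) {γ s : ℝ} {β : ℝ → ℝ}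
    (hβ : Continuous β) {g : Vec d → ℝ} (hg : Continuous g) (v : Vec d) :
    ∃ k : Vec d → ℝ, Measurable k ∧ ∀ w, w ≠ 0 → reducedKernel γ s β g v w = k w := by
  have he : ‖EuclideanSpace.single (⟨0, by omega⟩ : Fin d) (1 : ℝ)‖ = 1 := by simp
  have h1 : Measurable fun p : Vec d × Vec d => β (deviationAngle ‖p.1‖ ‖p.2‖) :=
    hβ.measurable.comp (measurable_deviationAngle.comp
      (f := fun p : Vec d × Vec d => (‖p.1‖, ‖p.2‖))
      ((measurable_norm.comp measurable_fst).prodMk (measurable_norm.comp measurable_snd)))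
  have h2 : Measurable fun p : Vec d × Vec d => g (v + p.2) :=
    hg.measurable.comp (measurable_snd.const_add v)
  have h3 : Measurable fun p : Vec d × Vec d => ‖p.2‖ ^ (γ + 2 * s + 1) :=
    (measurable_norm.comp measurable_snd).pow_const _
  have h4 : Measurable (Function.uncurry fun w z : Vec d => g (v + z) * ‖z‖ ^ (γ + 2 * s + 1) *
      β (deviationAngle ‖w‖ ‖z‖)) := (h2.mul h3).mul h1
  obtain ⟨k, hk, hk2⟩ := exists_measurable_integral_orthogonal he h4
  refine ⟨fun w => ‖w‖ ^ (-(d : ℝ) - 2 * s) * k w, (measurable_norm.pow_const _).mul hk,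
    fun w hw => ?_⟩
  rw [reducedKernel, hk2 w hw]

/-! ### Upper bound of the kernel by mass and energy -/

/-- A continuous nonnegative density with mass at most `M` and energy at most `E`. -/
structure IsDensity {d : ℕ} (M E : ℝ) (g : Vec d → ℝ) : Prop where
  continuous : Continuous g
  nonneg : ∀ v, 0 ≤ g v
  integrable_mass : Integrable g
  mass_le : ∫ v, g v ≤ M
  integrable_energy : Integrable fun v => g v * ‖v‖ ^ 2
  energy_le : ∫ v, g v * ‖v‖ ^ 2 ≤ E

/-- Reduces a moment of order `p ∈ [0,2]` to mass and energy: after division by `R`, the base `u +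
2` is at least 1, so `p` may be raised to 2. -/
theorem rpow_le_of_le_two {p r R u : ℝ} (hp : p ∈ Icc (0 : ℝ) 2) (hR : 1 ≤ R) (hr : 0 ≤ r)
    (hru : r ≤ u + 2 * R) (hu : 0 ≤ u) : r ^ p ≤ R ^ p * (9 + 2 * u ^ 2) := by
  have hR0 : 0 < R := by linarith
  have h1 : (r / R) ^ p ≤ 9 + 2 * u ^ 2 := by
    have h2 : r / R ≤ u + 2 := by
      rw [div_le_iff₀ hR0]
      nlinarith
    calc (r / R) ^ p ≤ (u + 2) ^ p := Real.rpow_le_rpow (by positivity) h2 hp.1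
      _ ≤ (u + 2) ^ (2 : ℝ) := Real.rpow_le_rpow_of_exponent_le (by linarith) hp.2
      _ = (u + 2) ^ 2 := Real.rpow_two _
      _ ≤ _ := by nlinarith [sq_nonneg (u - 2)]
  rw [Real.div_rpow hr hR0.le, div_le_iff₀ (by positivity)] at h1
  linarith

/-- The factor `‖z‖⁻¹` is the one left by Carleman's formula. It lowers the exponent `γ + 2s + 1` of
the kernel to `p = γ + 2s`. -/
theorem IsDensity.lintegral_moment_le {d : ℕ} {M E : ℝ} {g : Vec d → ℝ} (hg : IsDensity M E g)
    {p R : ℝ} (hp : p ∈ Icc (0 : ℝ) 2) (hR : 1 ≤ R) {v : Vec d} (hv : ‖v‖ ≤ 2 * R) :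
    ∫⁻ z, ENNReal.ofReal ‖z‖⁻¹ * ENNReal.ofReal (g (v + z) * ‖z‖ ^ (p + 1)) ≤
      ENNReal.ofReal (R ^ p * (9 * M + 2 * E)) := by
  have hR0 : 0 < R := by linarith
  have h1 : ∀ z : Vec d, ENNReal.ofReal ‖z‖⁻¹ * ENNReal.ofReal (g (v + z) * ‖z‖ ^ (p + 1)) ≤
      ENNReal.ofReal (R ^ p * (9 * g (v + z) + 2 * (g (v + z) * ‖v + z‖ ^ 2))) := by
    intro z
    rw [← ENNReal.ofReal_mul (by positivity)]
    refine ENNReal.ofReal_le_ofReal ?_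
    have h2 : ‖z‖⁻¹ * ‖z‖ ^ (p + 1) ≤ ‖z‖ ^ p := by
      rcases eq_or_ne ‖z‖ 0 with h0 | h0
      · rw [h0, inv_zero, zero_mul]
        exact Real.rpow_nonneg le_rfl _
      · rw [Real.rpow_add_one h0]
        field_simp
        exact le_rfl
    have h3 : ‖z‖ ≤ ‖v + z‖ + 2 * R := by
      have := norm_sub_le (v + z) v
      rw [add_sub_cancel_left] at this
      linarith
    have h4 := rpow_le_of_le_two hp hR (norm_nonneg z) h3 (norm_nonneg _)
    calc ‖z‖⁻¹ * (g (v + z) * ‖z‖ ^ (p + 1)) = g (v + z) * (‖z‖⁻¹ * ‖z‖ ^ (p + 1)) := by ring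
      _ ≤ g (v + z) * (R ^ p * (9 + 2 * ‖v + z‖ ^ 2)) :=
        mul_le_mul_of_nonneg_left (h2.trans h4) (hg.nonneg _)
      _ = _ := by ring
  refine (lintegral_mono h1).trans ?_
  rw [lintegral_add_left_eq_self
    (fun u => ENNReal.ofReal (R ^ p * (9 * g u + 2 * (g u * ‖u‖ ^ 2)))) v]
  have i1 : Integrable fun u => 9 * g u := hg.integrable_mass.const_mul 9
  have i2 : Integrable fun u => 2 * (g u * ‖u‖ ^ 2) := hg.integrable_energy.const_mul 2
  have i3 : Integrable fun u => R ^ p * (9 * g u + 2 * (g u * ‖u‖ ^ 2)) :=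
    (i1.add i2).const_mul _
  rw [← ofReal_integral_eq_lintegral_ofReal i3
    (Eventually.of_forall fun u => by
      have := hg.nonneg u
      simp only [Pi.zero_apply]
      positivity)]
  refine ENNReal.ofReal_le_ofReal ?_
  rw [integral_const_mul, integral_add i1 i2, integral_const_mul, integral_const_mul]
  have := hg.mass_le
  have := hg.energy_le
  gcongr

theorem ofReal_reducedKernel_le {d : ℕ} {γ s : ℝ} {β : ℝ → ℝ} {B : ℝ} (hβ : Continuous β)
    (hβ0 : ∀ θ, 0 ≤ β θ) (hβB : ∀ θ, β θ ≤ B) {g : Vec d → ℝ} (hg : ∀ v, 0 ≤ g v)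
    (hgc : Continuous g) (v w : Vec d) :
    ENNReal.ofReal (reducedKernel γ s β g v w) ≤ ENNReal.ofReal (‖w‖ ^ (-(d : ℝ) - 2 * s)) *
      (ENNReal.ofReal B *
        ∫⁻ z : (ℝ ∙ w)ᗮ, ENNReal.ofReal (g (v + z) * ‖(z : Vec d)‖ ^ (γ + 2 * s + 1))) := by
  have hm : Measurable fun z : (ℝ ∙ w)ᗮ => g (v + z) * ‖(z : Vec d)‖ ^ (γ + 2 * s + 1) := by
    have h2 : Measurable fun z : (ℝ ∙ w)ᗮ => g (v + z) :=
      hgc.measurable.comp (measurable_subtype_coe.const_add v)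
    exact h2.mul ((measurable_norm.comp measurable_subtype_coe).pow_const _)
  have hm2 : Measurable fun z : (ℝ ∙ w)ᗮ => β (deviationAngle ‖w‖ ‖(z : Vec d)‖) :=
    hβ.measurable.comp (measurable_deviationAngle.comp
      (f := fun z : (ℝ ∙ w)ᗮ => (‖w‖, ‖(z : Vec d)‖))
      (measurable_const.prodMk (measurable_norm.comp measurable_subtype_coe)))
  unfold reducedKernel
  rw [ENNReal.ofReal_mul (by positivity)]
  gcongr
  rw [integral_eq_lintegral_of_nonneg_ae (Eventually.of_forall fun z =>
      mul_nonneg (mul_nonneg (hg _) (by positivity)) (hβ0 _)) (hm.mul hm2).aestronglyMeasurable]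
  refine ENNReal.ofReal_toReal_le.trans ?_
  rw [← lintegral_const_mul _ hm.ennreal_ofReal]
  refine lintegral_mono fun z => ?_
  rw [← ENNReal.ofReal_mul ((hβ0 0).trans (hβB 0)), mul_comm B]
  exact ENNReal.ofReal_le_ofReal (mul_le_mul_of_nonneg_left (hβB _)
    (mul_nonneg (hg _) (by positivity)))

/-- Carleman's change of variables with the weight `‖w‖^(-n-2s) min(...)`: integrated over `z^⊥` it
gives `δ^(-2s)` up to a constant, uniformly in `z`, and a moment of `g` remains. The second
conclusion is needed for lower bounds, since a divergent hyperplane integral would have the default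
value 0. -/
theorem lintegral_reducedKernel_mul_le {n : ℕ} (hn : 1 ≤ n) {γ s : ℝ} (hs : s ∈ Ioo (0 : ℝ) 1)
    (hγs : γ + 2 * s ∈ Icc (0 : ℝ) 2) {β : ℝ → ℝ} {B : ℝ} (hβ : Continuous β)
    (hβ0 : ∀ θ, 0 ≤ β θ) (hβB : ∀ θ, β θ ≤ B) {M E : ℝ} {g : Vec (n + 1) → ℝ}
    (hg : IsDensity M E g) {R δ : ℝ} (hR : 1 ≤ R) (hδ : 0 < δ) {v : Vec (n + 1)}
    (hv : ‖v‖ ≤ 2 * R) :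
    (∫⁻ w, ENNReal.ofReal (reducedKernel γ s β g v w * min ((‖w‖ / δ) ^ (1 + s)) 1) ≤
      ENNReal.ofReal (B * (tailConst n s * δ ^ (-(2 * s)) *
        (R ^ (γ + 2 * s) * (9 * M + 2 * E))))) ∧
    ∀ᵐ w : Vec (n + 1), ∫⁻ z : (ℝ ∙ w)ᗮ,
      ENNReal.ofReal (g (v + z) * ‖(z : Vec (n + 1))‖ ^ (γ + 2 * s + 1)) < ⊤ := by
  have hp : 0 ≤ γ + 2 * s + 1 := by linarith [hγs.1]
  have hB : 0 ≤ B := (hβ0 0).trans (hβB 0)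
  have hfr : Module.finrank ℝ (Vec (n + 1)) = n + 1 := by simp
  have hT0 : 0 ≤ tailConst n s * δ ^ (-(2 * s)) :=
    mul_nonneg (tailConst_pos hn hs).le (by positivity)
  have hGc : Continuous fun z : Vec (n + 1) =>
      ENNReal.ofReal (g (v + z) * ‖z‖ ^ (γ + 2 * s + 1)) := by
    have h1 : Continuous fun z : Vec (n + 1) => g (v + z) :=
      hg.continuous.comp (continuous_const_add v)
    exact ENNReal.continuous_ofReal.comp
      (h1.mul (continuous_norm.rpow_const fun _ => Or.inr hp))
  obtain ⟨Φ, hΦm, hΦ1, hΦ2⟩ := exists_majorant_lintegral_orthogonal (E := Vec (n + 1))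
    (by omega) (m := fun r => ENNReal.ofReal (tailWeight n s δ r))
    (measurable_tailWeight n s δ).ennreal_ofReal
    (fun r r' hr hrr => ENNReal.ofReal_le_ofReal (tailWeight_anti hn hs.1 hδ hr hrr))
    (fun r => ENNReal.ofReal_ne_top)
    (fun z hz => (lintegral_tailWeight hn (finrank_orthogonal_span hfr hz) hs hδ).le) hGc
  have hmom := hg.lintegral_moment_le hγs hR hv
  have hΦ3 : ∫⁻ w, ENNReal.ofReal (tailWeight n s δ ‖w‖) * Φ w ≤
      ENNReal.ofReal (tailConst n s * δ ^ (-(2 * s)) *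
        (R ^ (γ + 2 * s) * (9 * M + 2 * E))) := by
    refine hΦ2.trans ?_
    rw [ENNReal.ofReal_mul hT0]
    gcongr
  have hw0 : ∀ᵐ w : Vec (n + 1), w ≠ 0 :=
    measure_eq_zero_iff_ae_notMem.1 (measure_singleton (0 : Vec (n + 1)))
  have hmeas : Measurable fun w : Vec (n + 1) => ENNReal.ofReal (tailWeight n s δ ‖w‖) * Φ w :=
    ((measurable_tailWeight n s δ).comp measurable_norm).ennreal_ofReal.mul hΦm
  refine ⟨?_, ?_⟩
  · rw [ENNReal.ofReal_mul hB]
    refine le_trans ?_ (mul_le_mul_right hΦ3 (ENNReal.ofReal B))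
    rw [← lintegral_const_mul _ hmeas]
    refine lintegral_mono_ae ?_
    filter_upwards [hw0] with w hw
    have hw' : 0 < ‖w‖ := norm_pos_iff.2 hw
    have hmin : 0 ≤ min ((‖w‖ / δ) ^ (1 + s)) 1 := le_min (by positivity) zero_le_one
    have hk := reducedKernel_nonneg (γ := γ) (s := s) hβ0 hg.nonneg v w
    rw [ENNReal.ofReal_mul hk]
    calc _ ≤ (ENNReal.ofReal (‖w‖ ^ (-((n + 1 : ℕ) : ℝ) - 2 * s)) * (ENNReal.ofReal B *
        ∫⁻ z : (ℝ ∙ w)ᗮ, ENNReal.ofReal (g (v + z) *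
          ‖(z : Vec (n + 1))‖ ^ (γ + 2 * s + 1)))) *
            ENNReal.ofReal (min ((‖w‖ / δ) ^ (1 + s)) 1) := by
          gcongr
          exact ofReal_reducedKernel_le hβ hβ0 hβB hg.nonneg hg.continuous v w
      _ = ENNReal.ofReal B * ((ENNReal.ofReal (‖w‖ ^ (-((n + 1 : ℕ) : ℝ) - 2 * s)) *
          ENNReal.ofReal (min ((‖w‖ / δ) ^ (1 + s)) 1)) *
          ∫⁻ z : (ℝ ∙ w)ᗮ, ENNReal.ofReal (g (v + z) *
            ‖(z : Vec (n + 1))‖ ^ (γ + 2 * s + 1))) := by ring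
      _ = ENNReal.ofReal B * (ENNReal.ofReal (tailWeight n s δ ‖w‖) * (ENNReal.ofReal ‖w‖⁻¹ *
          ∫⁻ z : (ℝ ∙ w)ᗮ, ENNReal.ofReal (g (v + z) *
            ‖(z : Vec (n + 1))‖ ^ (γ + 2 * s + 1)))) := by
          rw [← mul_assoc (ENNReal.ofReal (tailWeight n s δ ‖w‖)),
            ← ENNReal.ofReal_mul (by positivity),
            ← ENNReal.ofReal_mul (tailWeight_nonneg hδ hw'.le)]
          congr 3
          unfold tailWeight
          have : ‖w‖ ^ (-((n + 1 : ℕ) : ℝ) - 2 * s) = ‖w‖ ^ (-(n : ℝ) - 2 * s) * ‖w‖⁻¹ := by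
            rw [← Real.rpow_neg_one, ← Real.rpow_add hw']
            push_cast
            ring_nf
          rw [this]
          ring
      _ ≤ _ := by
          gcongr
          exact hΦ1 w hw
  -- The weight is positive away from `w = 0`, so finiteness of the weighted integral forces the
  -- majorant `Φ` to be finite almost everywhere.
  · have hfin := ae_lt_top hmeas (hΦ3.trans_lt ENNReal.ofReal_lt_top).ne
    filter_upwards [hw0, hfin] with w hw hlt
    have hw' : 0 < ‖w‖ := norm_pos_iff.2 hw
    have hT : ENNReal.ofReal (tailWeight n s δ ‖w‖) ≠ 0 := by
      rw [Ne, ENNReal.ofReal_eq_zero, not_le]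
      unfold tailWeight
      have : 0 < min ((‖w‖ / δ) ^ (1 + s)) 1 := lt_min (by positivity) zero_lt_one
      positivity
    have h1 : Φ w < ⊤ := by
      by_contra h
      rw [not_lt, top_le_iff] at h
      rw [h, ENNReal.mul_top hT] at hlt
      exact lt_irrefl _ hlt
    have h2 := (hΦ1 w hw).trans_lt h1
    by_contra h
    rw [not_lt, top_le_iff] at h
    rw [h, ENNReal.mul_top] at h2
    · exact lt_irrefl _ h2
    · rw [Ne, ENNReal.ofReal_eq_zero, not_le]
      positivity

/-! ### Collisions near the angle `π / 4` and lower bound of the kernel -/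

/-- Relative velocities `w` whose component along `v` and whose distance to the line `ℝ v` are both
within `h` of `|v| / 2` (with `w` pointing backwards). -/
def diagonalShell {d : ℕ} (v : Vec d) (h : ℝ) : Set (Vec d) :=
  {w | |⟪v, w⟫ / ‖v‖ + ‖v‖ / 2| < h ∧ (‖v‖ / 2 - h) ^ 2 < ‖w‖ ^ 2 - (⟪v, w⟫ / ‖v‖) ^ 2 ∧
    ‖w‖ ^ 2 - (⟪v, w⟫ / ‖v‖) ^ 2 < (‖v‖ / 2 + h) ^ 2}

theorem measurableSet_diagonalShell {d : ℕ} (v : Vec d) (h : ℝ) :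
    MeasurableSet (diagonalShell v h) := by
  have h1 : Measurable fun w : Vec d => ⟪v, w⟫ / ‖v‖ := by fun_prop
  have h2 : Measurable fun w : Vec d => ‖w‖ ^ 2 - (⟪v, w⟫ / ‖v‖) ^ 2 := by fun_prop
  exact (measurableSet_lt (h1.add_const _).abs measurable_const).inter
    ((measurableSet_lt measurable_const h2).inter (measurableSet_lt h2 measurable_const))

theorem pow_sub_pow_ge {a b : ℝ} (ha : 0 ≤ a) (hab : a ≤ b) {n : ℕ} (hn : 1 ≤ n) :
    (b - a) * b ^ (n - 1) ≤ b ^ n - a ^ n := by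
  obtain ⟨k, rfl⟩ : ∃ k, n = k + 1 := ⟨n - 1, by omega⟩
  rw [Nat.add_sub_cancel, pow_succ, pow_succ]
  nlinarith [pow_le_pow_left₀ ha hab k]

theorem le_volume_diagonalShell {n : ℕ} (hn : 1 ≤ n) {v : Vec (n + 1)} (hv : v ≠ 0) {h : ℝ}
    (hh : 0 < h) (hhv : h ≤ ‖v‖ / 2) :
    ENNReal.ofReal (2 * h * (2 * h * (‖v‖ / 2) ^ (n - 1) * unitBallVolume n)) ≤
      volume (diagonalShell v h) := by
  have hV : 0 < ‖v‖ := norm_pos_iff.2 hv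
  have hfr : Module.finrank ℝ (ℝ ∙ v)ᗮ = n := finrank_orthogonal_span (by simp) hv
  set a := ‖v‖ / 2 - h with ha
  set b := ‖v‖ / 2 + h with hb
  have ha0 : 0 ≤ a := by linarith
  have hab : a < b := by linarith
  have hω := unitBallVolume_pos n
  rw [← lintegral_indicator_one (measurableSet_diagonalShell v h),
    lintegral_eq_lintegral_orthogonal hv
      (measurable_one.indicator (measurableSet_diagonalShell v h))]
  have hT : MeasurableSet {t : ℝ | |t + ‖v‖ / 2| < h} :=
    (isOpen_lt (by fun_prop) continuous_const).measurableSet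
  have hmem : ∀ (t : ℝ) (y : (ℝ ∙ v)ᗮ), |t + ‖v‖ / 2| < h → a < ‖y‖ → ‖y‖ < b →
      t • (‖v‖⁻¹ • v) + (y : Vec (n + 1)) ∈ diagonalShell v h := by
    intro t y ht hy1 hy2
    have e1 : ⟪v, t • (‖v‖⁻¹ • v) + (y : Vec (n + 1))⟫ / ‖v‖ = t := by
      rw [inner_add_right, inner_of_mem_orthogonal_span y.2, inner_smul_right, inner_smul_right,
        real_inner_self_eq_norm_sq]
      field_simp
      simp
    have e2 : ‖t • (‖v‖⁻¹ • v) + (y : Vec (n + 1))‖ ^ 2 = t ^ 2 + ‖y‖ ^ 2 := by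
      rw [norm_add_sq_real, inner_smul_left, inner_smul_left, inner_of_mem_orthogonal_span y.2,
        norm_smul, norm_smul, norm_inv, norm_norm, inv_mul_cancel₀ hV.ne', mul_one,
        Real.norm_eq_abs, sq_abs]
      simp
    refine ⟨by rwa [e1], ?_, ?_⟩ <;> rw [e1, e2, add_sub_cancel_left]
    · exact pow_lt_pow_left₀ hy1 ha0 two_ne_zero
    · exact pow_lt_pow_left₀ hy2 (norm_nonneg _) two_ne_zero
  have hann : ENNReal.ofReal (2 * h * (‖v‖ / 2) ^ (n - 1) * unitBallVolume n) ≤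
      volume (Metric.ball (0 : (ℝ ∙ v)ᗮ) b \ Metric.closedBall 0 a) := by
    have : Nontrivial (ℝ ∙ v)ᗮ := Module.nontrivial_of_finrank_pos (R := ℝ) (by omega)
    rw [measure_sdiff (Metric.closedBall_subset_ball hab)
      Metric.isClosed_closedBall.measurableSet.nullMeasurableSet (by
        rw [Measure.addHaar_closedBall_eq_addHaar_ball]
        exact measure_ball_lt_top.ne),
      Measure.addHaar_closedBall_eq_addHaar_ball, volume_ball_of_finrank hn hfr 0 (by linarith),
      volume_ball_of_finrank hn hfr 0 ha0, ← ENNReal.ofReal_sub _ (by positivity)]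
    refine ENNReal.ofReal_le_ofReal ?_
    rw [← sub_mul]
    refine mul_le_mul_of_nonneg_right ?_ hω.le
    refine le_trans ?_ (pow_sub_pow_ge ha0 hab.le hn)
    have e : b - a = 2 * h := by rw [ha, hb]; ring
    rw [e]
    gcongr
    linarith
  calc _ = ∫⁻ t in {t : ℝ | |t + ‖v‖ / 2| < h},
        ENNReal.ofReal (2 * h * (‖v‖ / 2) ^ (n - 1) * unitBallVolume n) := by
        have hvol : volume {t : ℝ | |t + ‖v‖ / 2| < h} = ENNReal.ofReal (2 * h) := by
          have : {t : ℝ | |t + ‖v‖ / 2| < h} = Ioo (-h - ‖v‖ / 2) (h - ‖v‖ / 2) := by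
            ext t
            simp only [mem_ofPred_eq, mem_Ioo, abs_lt]
            constructor <;> rintro ⟨h1, h2⟩ <;> constructor <;> linarith
          rw [this, Real.volume_Ioo]
          ring_nf
        rw [setLIntegral_const, hvol, ENNReal.ofReal_mul (by positivity), mul_comm]
    _ ≤ ∫⁻ t in {t : ℝ | |t + ‖v‖ / 2| < h}, ∫⁻ y : (ℝ ∙ v)ᗮ,
        (diagonalShell v h).indicator 1 (t • (‖v‖⁻¹ • v) + (y : Vec (n + 1))) := by
        refine setLIntegral_mono_ae' hT (Eventually.of_forall fun t ht => hann.trans ?_)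
        have hms : MeasurableSet (Metric.ball (0 : (ℝ ∙ v)ᗮ) b \ Metric.closedBall 0 a) :=
          measurableSet_ball.diff measurableSet_closedBall
        rw [← lintegral_indicator_one hms]
        refine lintegral_mono fun y => ?_
        by_cases hy : y ∈ Metric.ball (0 : (ℝ ∙ v)ᗮ) b \ Metric.closedBall 0 a
        · have hy' := hy
          rw [Set.mem_sdiff, mem_ball_zero_iff, mem_closedBall_zero_iff, not_le] at hy'
          rw [indicator_of_mem hy, indicator_of_mem (hmem t y ht hy'.2 hy'.1)]
          simp
        · rw [indicator_of_notMem hy]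
          exact zero_le
    _ ≤ _ := setLIntegral_le_lintegral _ _

/-- Elementary estimates behind the geometry of a collision from `v` along a direction at
angle close to `π / 4`. Here `t` and `r` are the components of `w` along and orthogonal to `v`. -/
theorem shell_arithmetic {R ξ V t r : ℝ} (hR : 1 ≤ R) (hξ : 0 < ξ) (hξ1 : ξ < 1 / 3) (hV1 : R ≤ V)
    (hV2 : V < √2 * (1 - ξ / 2) * R) (ht : |t + V / 2| < ξ * R / 32)
    (hr0 : 0 ≤ r) (hr1 : V / 2 - ξ * R / 32 < r) (hr2 : r < V / 2 + ξ * R / 32) :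
    (R / 4) ^ 2 ≤ t ^ 2 + r ^ 2 ∧ t ^ 2 + r ^ 2 ≤ (3 * R) ^ 2 ∧
    V ^ 2 + 2 * (V * t) + (t ^ 2 + r ^ 2) < R ^ 2 ∧
    V ^ 2 * t ^ 2 ≤ (R * (1 - ξ / 4)) ^ 2 * (t ^ 2 + r ^ 2) ∧
    (R / 2) ^ 2 * (t ^ 2 + r ^ 2) ≤ V ^ 2 * r ^ 2 := by
  have hR0 : 0 < R := by linarith
  have hV0 : 0 < V := by linarith
  have hξR : 0 < ξ * R := by positivity
  have hξR3 : ξ * R < R / 3 := by nlinarith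
  have hVsq : V ^ 2 < 2 * (1 - ξ / 2) ^ 2 * R ^ 2 := by
    have h2 : √2 ^ 2 = 2 := Real.sq_sqrt zero_le_two
    calc V ^ 2 < (√2 * (1 - ξ / 2) * R) ^ 2 := pow_lt_pow_left₀ hV2 hV0.le two_ne_zero
      _ = √2 ^ 2 * (1 - ξ / 2) ^ 2 * R ^ 2 := by ring
      _ = _ := by rw [h2]
  have hV3 : V ≤ 3 / 2 * R := by
    have : V ^ 2 < (3 / 2 * R) ^ 2 := by
      refine hVsq.trans_le ?_
      have : (1 - ξ / 2) ^ 2 ≤ 1 := by nlinarith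
      nlinarith [sq_nonneg R]
    exact (lt_of_pow_lt_pow_left₀ 2 (by positivity) this).le
  rw [abs_lt] at ht
  obtain ⟨ht1, ht2⟩ := ht
  set τ := -t with hτ
  have htτ : t ^ 2 = τ ^ 2 := by rw [hτ]; ring
  have hVt : V * t = -(V * τ) := by rw [hτ]; ring
  have hτ1 : V / 2 - ξ * R / 32 < τ := by linarith
  have hτ2 : τ < V / 2 + ξ * R / 32 := by linarith
  have hτR : R / 4 < τ := by linarith
  have hrR : R / 4 < r := by linarith
  have hξτ : ξ * (R / 4) ≤ ξ * τ := mul_le_mul_of_nonneg_left hτR.le hξ.le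
  have hξr : ξ * (R / 4) ≤ ξ * r := mul_le_mul_of_nonneg_left hrR.le hξ.le
  have hrτ : τ * (1 - ξ / 4) ≤ r := by linarith
  have hrτ' : τ ≤ r * (1 + ξ / 4) := by linarith
  rw [htτ, hVt]
  have hτsq : (R / 4) ^ 2 ≤ τ ^ 2 := pow_le_pow_left₀ (by positivity) hτR.le 2
  refine ⟨by linarith [sq_nonneg r], ?_, ?_, ?_, ?_⟩
  · have h1 : τ ^ 2 ≤ R ^ 2 := pow_le_pow_left₀ (by linarith) (by linarith) 2
    have h2 : r ^ 2 ≤ R ^ 2 := pow_le_pow_left₀ hr0 (by linarith) 2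
    linarith [sq_nonneg R]
  -- The left side is `(V - τ)² + r²`, that is `|v + w|²`. Both squares are below `m²`, and `m ≤
  -- R/√2`.
  · set m := V / 2 + ξ * R / 32 with hm
    have h2 : √2 ^ 2 = 2 := Real.sq_sqrt zero_le_two
    have h3 : 1 ≤ √2 := Real.one_le_sqrt.2 one_le_two
    have hm1 : m ≤ √2 / 2 * R := by nlinarith
    have hm2 : m ^ 2 ≤ R ^ 2 / 2 := by
      calc m ^ 2 ≤ (√2 / 2 * R) ^ 2 := pow_le_pow_left₀ (by positivity) hm1 2
        _ = √2 ^ 2 * R ^ 2 / 4 := by ring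
        _ = R ^ 2 / 2 := by rw [h2]; ring
    have h4 : (V - τ) ^ 2 < m ^ 2 :=
      pow_lt_pow_left₀ (by linarith) (by linarith) two_ne_zero
    have h5 : r ^ 2 < m ^ 2 := pow_lt_pow_left₀ hr2 hr0 two_ne_zero
    linarith
  · have h1 : (τ * (1 - ξ / 4)) ^ 2 ≤ r ^ 2 :=
      pow_le_pow_left₀ (by nlinarith) hrτ 2
    have h2 : 2 * τ ^ 2 * (1 - ξ / 4) ≤ τ ^ 2 + r ^ 2 := by nlinarith [sq_nonneg (τ * ξ)]
    have h3 : (1 - ξ / 2) ^ 2 ≤ (1 - ξ / 4) ^ 2 * (1 - ξ / 4) := by nlinarith [sq_nonneg ξ]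
    calc V ^ 2 * τ ^ 2 ≤ 2 * (1 - ξ / 2) ^ 2 * R ^ 2 * τ ^ 2 := by gcongr
      _ = (1 - ξ / 2) ^ 2 * (2 * R ^ 2 * τ ^ 2) := by ring
      _ ≤ ((1 - ξ / 4) ^ 2 * (1 - ξ / 4)) * (2 * R ^ 2 * τ ^ 2) := by gcongr
      _ = (R * (1 - ξ / 4)) ^ 2 * (2 * τ ^ 2 * (1 - ξ / 4)) := by ring
      _ ≤ _ := by gcongr
  · have h1 : τ ≤ r * (13 / 12) := by nlinarith
    have h2 : τ ^ 2 ≤ (r * (13 / 12)) ^ 2 := pow_le_pow_left₀ (by linarith) h1 2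
    have h3 : R ^ 2 ≤ V ^ 2 := pow_le_pow_left₀ hR0.le hV1 2
    have h4 : τ ^ 2 + r ^ 2 ≤ 4 * r ^ 2 := by linarith [sq_nonneg r]
    calc (R / 2) ^ 2 * (τ ^ 2 + r ^ 2) ≤ (R / 2) ^ 2 * (4 * r ^ 2) := by gcongr
      _ = R ^ 2 * r ^ 2 := by ring
      _ ≤ _ := by gcongr

/-- The profile may vanish at `π`. The ratio bound keeps the cosine above `(1 - 144)/(1 + 144) =
-143/145`, and 12 is the ratio of the bounds `‖w‖ ≤ 3R` and `‖z‖ ≥ R/4` on the shell. -/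
theorem IsAngularProfile.exists_lower_bound {d : ℕ} {γ s B : ℝ} {b β : ℝ → ℝ}
    (hβ : IsAngularProfile d γ s b β B) :
    ∃ β₀ : ℝ, 0 < β₀ ∧ ∀ r ρ : ℝ, 0 < r → r ≤ 12 * ρ → β₀ ≤ β (deviationAngle r ρ) := by
  set θ₀ := Real.arccos (-143 / 145) with hθ₀
  have h0 : 0 ≤ θ₀ := Real.arccos_nonneg _
  have h1 : θ₀ < Real.pi := by
    refine lt_of_le_of_ne (Real.arccos_le_pi _) fun h => ?_
    have := Real.cos_arccos (x := -143 / 145) (by norm_num) (by norm_num)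
    rw [← hθ₀, h, Real.cos_pi] at this
    norm_num at this
  obtain ⟨θ, hθ, hmin⟩ := isCompact_Icc.exists_isMinOn (nonempty_Icc.2 h0)
    hβ.continuous.continuousOn
  refine ⟨β θ, hβ.pos θ ⟨hθ.1, hθ.2.trans_lt h1⟩, fun r ρ hr hrρ => hmin ⟨Real.arccos_nonneg _, ?_⟩⟩
  refine Real.arccos_le_arccos ?_
  have hρ : 0 < ρ := by linarith
  rw [div_le_div_iff₀ (by norm_num) (by positivity)]
  have : r ^ 2 ≤ (12 * ρ) ^ 2 := pow_le_pow_left₀ hr.le hrρ 2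
  linarith

theorem diagonalShell_geometry {d : ℕ} {R ξ : ℝ} (hR : 1 ≤ R) (hξ : 0 < ξ) (hξ1 : ξ < 1 / 3)
    {v w : Vec d} (hV1 : R ≤ ‖v‖) (hV2 : ‖v‖ < √2 * (1 - ξ / 2) * R)
    (hw : w ∈ diagonalShell v (ξ * R / 32)) :
    R / 4 ≤ ‖w‖ ∧ ‖w‖ ≤ 3 * R ∧ ‖v + w‖ < R ∧
    ∃ z₀ : (ℝ ∙ w)ᗮ, ∀ z ∈ Metric.ball z₀ (ξ * R / 8),
      ‖v + (z : Vec d)‖ < R ∧ R / 4 ≤ ‖(z : Vec d)‖ := by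
  have hR0 : 0 < R := by linarith
  have hv : 0 < ‖v‖ := by linarith
  obtain ⟨hw1, hw2, hw3⟩ := hw
  set t := ⟪v, w⟫ / ‖v‖ with ht
  have hvw : ⟪v, w⟫ = ‖v‖ * t := by rw [ht]; field_simp
  set r := √(‖w‖ ^ 2 - t ^ 2) with hr
  have hrsq : r ^ 2 = ‖w‖ ^ 2 - t ^ 2 := Real.sq_sqrt (by
    exact (sq_nonneg _).trans hw2.le)
  have hr0 : 0 ≤ r := Real.sqrt_nonneg _
  have hξR : ξ * R ≤ R := by nlinarith
  have hr1 : ‖v‖ / 2 - ξ * R / 32 < r := by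
    rw [← hrsq] at hw2
    exact lt_of_pow_lt_pow_left₀ 2 hr0 hw2
  have hr2 : r < ‖v‖ / 2 + ξ * R / 32 := by
    rw [← hrsq] at hw3
    exact lt_of_pow_lt_pow_left₀ 2 (by positivity) hw3
  obtain ⟨a1, a2, a3, a4, a5⟩ := shell_arithmetic hR hξ hξ1 hV1 hV2 hw1 hr0 hr1 hr2
  have hsum : t ^ 2 + r ^ 2 = ‖w‖ ^ 2 := by rw [hrsq]; ring
  rw [hsum] at a1 a2 a3 a4 a5
  have hw4 : R / 4 ≤ ‖w‖ := le_of_sq_le_sq a1 (norm_nonneg _)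
  have hw0 : 0 < ‖w‖ := by linarith
  refine ⟨hw4, le_of_sq_le_sq a2 (by positivity), ?_, ?_⟩
  · refine lt_of_pow_lt_pow_left₀ 2 hR0.le ?_
    rw [norm_add_sq_real, hvw]
    exact a3
  -- With this choice `v + z₀` is the projection of `v` on `ℝ w`, of norm at most `R(1 - ξ/4)`. The
  -- remaining margin `ξR/4` accommodates a ball of radius `ξR/8`.
  · set z₀ : Vec d := (⟪v, w⟫ / ‖w‖ ^ 2) • w - v with hz₀
    have hmem : z₀ ∈ (ℝ ∙ w)ᗮ := by
      refine mem_orthogonal_span_of_inner ?_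
      rw [hz₀, inner_sub_right, inner_smul_right, real_inner_self_eq_norm_sq, real_inner_comm]
      field_simp
      ring
    have h1 : ‖v + z₀‖ ≤ R * (1 - ξ / 4) := by
      refine le_of_sq_le_sq ?_ (mul_nonneg hR0.le (by linarith))
      have : ‖v + z₀‖ ^ 2 * ‖w‖ ^ 2 = ‖v‖ ^ 2 * t ^ 2 := by
        rw [hz₀, add_sub_cancel, norm_smul, hvw, Real.norm_eq_abs, mul_pow, sq_abs]
        field_simp
      rw [← this] at a4
      exact le_of_mul_le_mul_right a4 (by positivity)
    have h2 : R / 2 ≤ ‖z₀‖ := by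
      refine le_of_sq_le_sq ?_ (norm_nonneg _)
      have : ‖z₀‖ ^ 2 * ‖w‖ ^ 2 = ‖v‖ ^ 2 * r ^ 2 := by
        rw [hz₀, norm_sub_sq_real, norm_smul, inner_smul_left, real_inner_comm v w, hvw,
          Real.norm_eq_abs, mul_pow, sq_abs, hrsq]
        simp only [conj_trivial]
        field_simp
        ring
      rw [← this] at a5
      exact le_of_mul_le_mul_right a5 (by positivity)
    refine ⟨⟨z₀, hmem⟩, fun z hz => ?_⟩
    have h3 : ‖(z : Vec d) - z₀‖ < ξ * R / 8 := by
      rw [mem_ball_iff_norm] at hz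
      exact hz
    constructor
    · have h4 : v + (z : Vec d) = (v + z₀) + ((z : Vec d) - z₀) := by abel
      have h5 := norm_add_le (v + z₀) ((z : Vec d) - z₀)
      rw [← h4] at h5
      nlinarith
    · have h5 := norm_sub_norm_le z₀ (z : Vec d)
      rw [norm_sub_rev z₀ (z : Vec d)] at h5
      linarith

/-- The constant in the pointwise lower bound of the kernel on the diagonal shell. -/
noncomputable def kernelConst (n : ℕ) (γ s β₀ : ℝ) : ℝ :=
  3 ^ (-((n + 1 : ℕ) : ℝ) - 2 * s) * (1 / 4) ^ (γ + 2 * s + 1) * β₀ * (1 / 8) ^ n *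
    unitBallVolume n

theorem kernelConst_pos {n : ℕ} {γ s β₀ : ℝ} (hβ₀ : 0 < β₀) : 0 < kernelConst n γ s β₀ := by
  have := unitBallVolume_pos n
  unfold kernelConst
  positivity

/-- Only the ball of radius `ξR/8` in the `n`-dimensional hyperplane is kept, where `g ≥ l` and `‖z‖
≥ R/4`; the powers of `R` combine to `R^γ`. `hfin` makes the Bochner integral monotone. -/
theorem le_reducedKernel {n : ℕ} (hn : 1 ≤ n) {γ s B β₀ : ℝ} (hγs : 0 ≤ γ + 2 * s) (hs : 0 ≤ s)
    {b β : ℝ → ℝ} (hβ : IsAngularProfile (n + 1) γ s b β B) (hβ₀ : 0 < β₀)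
    (hlow : ∀ r ρ : ℝ, 0 < r → r ≤ 12 * ρ → β₀ ≤ β (deviationAngle r ρ))
    {g : Vec (n + 1) → ℝ} (hgc : Continuous g) (hg : ∀ v, 0 ≤ g v)
    {R l ξ : ℝ} (hR : 1 ≤ R) (hl : 0 ≤ l) (hgl : ∀ v ∈ Metric.ball (0 : Vec (n + 1)) R, l ≤ g v)
    (hξ : 0 < ξ) (hξ1 : ξ < 1 / 3) {v w : Vec (n + 1)} (hV1 : R ≤ ‖v‖)
    (hV2 : ‖v‖ < √2 * (1 - ξ / 2) * R) (hw : w ∈ diagonalShell v (ξ * R / 32))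
    (hfin : ∫⁻ z : (ℝ ∙ w)ᗮ,
      ENNReal.ofReal (g (v + z) * ‖(z : Vec (n + 1))‖ ^ (γ + 2 * s + 1)) < ⊤) :
    kernelConst n γ s β₀ * l * ξ ^ n * R ^ γ ≤ reducedKernel γ s β g v w := by
  have hR0 : 0 < R := by linarith
  obtain ⟨hw1, hw2, -, z₀, hz₀⟩ := diagonalShell_geometry hR hξ hξ1 hV1 hV2 hw
  have hw0 : 0 < ‖w‖ := by linarith
  have hfr : Module.finrank ℝ (ℝ ∙ w)ᗮ = n :=
    finrank_orthogonal_span (by simp) (norm_pos_iff.1 hw0)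
  set F : (ℝ ∙ w)ᗮ → ℝ := fun z => g (v + z) * ‖(z : Vec (n + 1))‖ ^ (γ + 2 * s + 1) *
      β (deviationAngle ‖w‖ ‖(z : Vec (n + 1))‖) with hF
  have hF0 : ∀ z, 0 ≤ F z := fun z =>
    mul_nonneg (mul_nonneg (hg _) (by positivity)) (hβ.nonneg _)
  have hm : Measurable fun z : (ℝ ∙ w)ᗮ => g (v + z) * ‖(z : Vec (n + 1))‖ ^ (γ + 2 * s + 1) := by
    have h2 : Measurable fun z : (ℝ ∙ w)ᗮ => g (v + z) :=
      hgc.measurable.comp (measurable_subtype_coe.const_add v)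
    exact h2.mul ((measurable_norm.comp measurable_subtype_coe).pow_const _)
  have hm2 : Measurable fun z : (ℝ ∙ w)ᗮ => β (deviationAngle ‖w‖ ‖(z : Vec (n + 1))‖) :=
    hβ.continuous.measurable.comp (measurable_deviationAngle.comp
      (f := fun z : (ℝ ∙ w)ᗮ => (‖w‖, ‖(z : Vec (n + 1))‖))
      (measurable_const.prodMk (measurable_norm.comp measurable_subtype_coe)))
  have hi1 : Integrable fun z : (ℝ ∙ w)ᗮ =>
      g (v + z) * ‖(z : Vec (n + 1))‖ ^ (γ + 2 * s + 1) := by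
    refine ⟨hm.aestronglyMeasurable, ?_⟩
    rw [hasFiniteIntegral_iff_ofReal (Eventually.of_forall fun z =>
      mul_nonneg (hg _) (by positivity))]
    exact hfin
  have hint : Integrable F := by
    refine hi1.mul_bdd (c := B) hm2.aestronglyMeasurable (Eventually.of_forall fun z => ?_)
    rw [Real.norm_eq_abs, abs_of_nonneg (hβ.nonneg _)]
    exact hβ.le _
  have hball : ∀ z ∈ Metric.ball z₀ (ξ * R / 8),
      l * (R / 4) ^ (γ + 2 * s + 1) * β₀ ≤ F z := by
    intro z hz
    obtain ⟨h1, h2⟩ := hz₀ z hz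
    have h3 := hgl (v + z) (mem_ball_zero_iff.2 h1)
    have h4 : (R / 4) ^ (γ + 2 * s + 1) ≤ ‖(z : Vec (n + 1))‖ ^ (γ + 2 * s + 1) :=
      Real.rpow_le_rpow (by positivity) h2 (by linarith)
    have h5 := hlow ‖w‖ ‖(z : Vec (n + 1))‖ hw0 (by linarith)
    have h6 := hg (v + z)
    simp only [hF]
    gcongr
  have hvol : volume (Metric.ball z₀ (ξ * R / 8)) =
      ENNReal.ofReal ((ξ * R / 8) ^ n * unitBallVolume n) :=
    volume_ball_of_finrank hn hfr z₀ (by positivity)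
  have hω := unitBallVolume_pos n
  have h1 : ((ξ * R / 8) ^ n * unitBallVolume n) * (l * (R / 4) ^ (γ + 2 * s + 1) * β₀) ≤
      ∫ z, F z := by
    calc _ = ∫ z in Metric.ball z₀ (ξ * R / 8), l * (R / 4) ^ (γ + 2 * s + 1) * β₀ := by
          rw [setIntegral_const, Measure.real, hvol, ENNReal.toReal_ofReal (by positivity),
            smul_eq_mul]
      _ ≤ ∫ z in Metric.ball z₀ (ξ * R / 8), F z := by
          refine setIntegral_mono_on ?_ hint.integrableOn measurableSet_ball hball
          exact integrableOn_const (by rw [hvol]; exact ENNReal.ofReal_ne_top)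
      _ ≤ _ := setIntegral_le_integral hint (Eventually.of_forall hF0)
  have h2 : (3 * R) ^ (-((n + 1 : ℕ) : ℝ) - 2 * s) ≤ ‖w‖ ^ (-((n + 1 : ℕ) : ℝ) - 2 * s) := by
    refine Real.rpow_le_rpow_of_nonpos hw0 hw2 ?_
    have : (0 : ℝ) ≤ ((n + 1 : ℕ) : ℝ) := Nat.cast_nonneg _
    linarith
  have h3 : R ^ (-((n + 1 : ℕ) : ℝ) - 2 * s) * R ^ (γ + 2 * s + 1) * R ^ n = R ^ γ := by
    rw [← Real.rpow_natCast R n, ← Real.rpow_add hR0, ← Real.rpow_add hR0]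
    congr 1
    push_cast
    ring
  calc kernelConst n γ s β₀ * l * ξ ^ n * R ^ γ
      = (3 * R) ^ (-((n + 1 : ℕ) : ℝ) - 2 * s) *
        (((ξ * R / 8) ^ n * unitBallVolume n) * (l * (R / 4) ^ (γ + 2 * s + 1) * β₀)) := by
        rw [← h3, Real.mul_rpow (by norm_num) hR0.le, div_eq_mul_one_div R 4,
          Real.mul_rpow hR0.le (by norm_num), kernelConst]
        ring
    _ ≤ _ := mul_le_mul h2 h1 (by positivity) (by positivity)

/-- The constant in the lower bound of the integrated kernel. -/
noncomputable def gainConst (n : ℕ) (γ s β₀ : ℝ) : ℝ :=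
  kernelConst n γ s β₀ * (unitBallVolume n / 256 * (1 / 2) ^ (n - 1))

theorem gainConst_pos {n : ℕ} {γ s β₀ : ℝ} (hβ₀ : 0 < β₀) : 0 < gainConst n γ s β₀ := by
  have := unitBallVolume_pos n
  have := kernelConst_pos (n := n) (γ := γ) (s := s) hβ₀
  unfold gainConst
  positivity

theorem le_setIntegral_reducedKernel {n : ℕ} (hn : 1 ≤ n) {γ s B β₀ : ℝ} (hγs : 0 ≤ γ + 2 * s)
    (hs : 0 ≤ s) {b β : ℝ → ℝ} (hβ : IsAngularProfile (n + 1) γ s b β B) (hβ₀ : 0 < β₀)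
    (hlow : ∀ r ρ : ℝ, 0 < r → r ≤ 12 * ρ → β₀ ≤ β (deviationAngle r ρ))
    {g : Vec (n + 1) → ℝ} (hgc : Continuous g) (hg : ∀ v, 0 ≤ g v)
    {R l ξ : ℝ} (hR : 1 ≤ R) (hl : 0 ≤ l) (hgl : ∀ v ∈ Metric.ball (0 : Vec (n + 1)) R, l ≤ g v)
    (hξ : 0 < ξ) (hξ1 : ξ < 1 / 3) {v : Vec (n + 1)} (hV1 : R ≤ ‖v‖)
    (hV2 : ‖v‖ < √2 * (1 - ξ / 2) * R)
    (hfin : ∀ᵐ w : Vec (n + 1), ∫⁻ z : (ℝ ∙ w)ᗮ,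
      ENNReal.ofReal (g (v + z) * ‖(z : Vec (n + 1))‖ ^ (γ + 2 * s + 1)) < ⊤)
    (hint : IntegrableOn (reducedKernel γ s β g v) (diagonalShell v (ξ * R / 32))) :
    gainConst n γ s β₀ * l * ξ ^ (n + 2) * (R ^ (n + 1) * R ^ γ) ≤
      ∫ w in diagonalShell v (ξ * R / 32), reducedKernel γ s β g v w := by
  have hR0 : 0 < R := by linarith
  have hv0 : v ≠ 0 := norm_pos_iff.1 (by linarith)
  have hω := unitBallVolume_pos n
  have hkc := kernelConst_pos (n := n) (γ := γ) (s := s) hβ₀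
  set W := diagonalShell v (ξ * R / 32) with hW
  have hWm : MeasurableSet W := measurableSet_diagonalShell _ _
  have hbd : volume W < ⊤ := by
    refine lt_of_le_of_lt (measure_mono (t := Metric.closedBall 0 (3 * R)) fun w hw => ?_)
      measure_closedBall_lt_top
    exact mem_closedBall_zero_iff.2 (diagonalShell_geometry hR hξ hξ1 hV1 hV2 hw).2.1
  have hvol := le_volume_diagonalShell hn hv0 (h := ξ * R / 32) (by positivity) (by nlinarith)
  have hvol' : unitBallVolume n / 256 * (1 / 2) ^ (n - 1) * ξ ^ 2 * R ^ (n + 1) ≤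
      volume.real W := by
    rw [Measure.real, ← ENNReal.ofReal_le_iff_le_toReal hbd.ne]
    refine le_trans (ENNReal.ofReal_le_ofReal ?_) hvol
    obtain ⟨k, rfl⟩ : ∃ k, n = k + 1 := ⟨n - 1, by omega⟩
    rw [Nat.add_sub_cancel]
    calc _ = 2 * (ξ * R / 32) * (2 * (ξ * R / 32) * (R / 2) ^ k * unitBallVolume (k + 1)) := by
          rw [div_eq_mul_one_div R 2, mul_pow]; ring
      _ ≤ _ := by gcongr
  calc _ = (unitBallVolume n / 256 * (1 / 2) ^ (n - 1) * ξ ^ 2 * R ^ (n + 1)) *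
        (kernelConst n γ s β₀ * l * ξ ^ n * R ^ γ) := by unfold gainConst; ring
    _ ≤ volume.real W * (kernelConst n γ s β₀ * l * ξ ^ n * R ^ γ) := by gcongr
    _ = ∫ w in W, kernelConst n γ s β₀ * l * ξ ^ n * R ^ γ := by
        rw [setIntegral_const, smul_eq_mul]
    _ ≤ _ := by
        refine setIntegral_mono_on_ae (integrableOn_const hbd.ne) hint hWm ?_
        filter_upwards [hfin] with w hw hwW
        exact le_reducedKernel hn hγs hs hβ hβ₀ hlow hgc hg hR hl hgl hξ hξ1 hV1 hV2 hwW hw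

/-! ### The bump function and its second differences -/

/-- A semiconvex bump: `1` on the ball of radius `ρ` and `0` outside the ball of radius `ρ + δ`. -/
noncomputable def bump {d : ℕ} (ρ δ : ℝ) (v : Vec d) : ℝ :=
  max 0 (1 - (max 0 (‖v‖ - ρ) / δ) ^ 2)

theorem continuous_bump {d : ℕ} (ρ δ : ℝ) : Continuous (bump (d := d) ρ δ) := by
  unfold bump
  fun_prop

theorem bump_nonneg {d : ℕ} (ρ δ : ℝ) (v : Vec d) : 0 ≤ bump ρ δ v := le_max_left _ _

theorem bump_le_one {d : ℕ} (ρ δ : ℝ) (v : Vec d) : bump ρ δ v ≤ 1 :=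
  max_le zero_le_one (by linarith [sq_nonneg (max 0 (‖v‖ - ρ) / δ)])

theorem bump_eq_one {d : ℕ} {ρ δ : ℝ} {v : Vec d} (hv : ‖v‖ ≤ ρ) : bump ρ δ v = 1 := by
  rw [bump, max_eq_left (sub_nonpos.2 hv)]
  norm_num

theorem bump_eq_zero {d : ℕ} {ρ δ : ℝ} (hδ : 0 < δ) {v : Vec d} (hv : ρ + δ ≤ ‖v‖) :
    bump ρ δ v = 0 := by
  rw [bump, max_eq_right (a := 0) (b := ‖v‖ - ρ) (by linarith)]
  refine max_eq_left ?_
  have : 1 ≤ (‖v‖ - ρ) / δ := by rw [le_div_iff₀ hδ]; linarith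
  nlinarith

/-- Let `p` be the projection of `v` on the ball of radius `ρ`. Where the bump is positive, the
paraboloid `1 - |u - p|²/δ²` touches it from below at `v`, and its second difference is exactly
`-2|w|²/δ²`. Interpolation with the trivial bound `-2` gives the power `1 + s`. -/
theorem bump_second_difference {d : ℕ} {ρ δ s : ℝ} (hρ : 0 ≤ ρ) (hδ : 0 < δ)
    (hs : s ∈ Ioo (0 : ℝ) 1) (v w : Vec d) :
    -(2 * min ((‖w‖ / δ) ^ (1 + s)) 1) ≤ bump ρ δ (v + w) + bump ρ δ (v - w) - 2 * bump ρ δ v := by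
  have h1 : -2 ≤ bump ρ δ (v + w) + bump ρ δ (v - w) - 2 * bump ρ δ v := by
    linarith [bump_nonneg ρ δ (v + w), bump_nonneg ρ δ (v - w), bump_le_one ρ δ v]
  have h2 : -(2 * (‖w‖ / δ) ^ 2) ≤ bump ρ δ (v + w) + bump ρ δ (v - w) - 2 * bump ρ δ v := by
    rcases le_or_gt (1 - (max 0 (‖v‖ - ρ) / δ) ^ 2) 0 with h | h
    · have : bump ρ δ v = 0 := max_eq_left h
      linarith [bump_nonneg ρ δ (v + w), bump_nonneg ρ δ (v - w), sq_nonneg (‖w‖ / δ)]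
    · obtain ⟨p, hp1, hp2⟩ : ∃ p : Vec d, ‖p‖ ≤ ρ ∧ ‖v - p‖ = max 0 (‖v‖ - ρ) := by
        rcases le_or_gt ‖v‖ ρ with hv | hv
        · exact ⟨v, hv, by rw [sub_self, norm_zero, max_eq_left (sub_nonpos.2 hv)]⟩
        · have hv0 : 0 < ‖v‖ := hρ.trans_lt hv
          refine ⟨(ρ / ‖v‖) • v, ?_, ?_⟩
          · rw [norm_smul, Real.norm_eq_abs, abs_of_nonneg (by positivity), div_mul_cancel₀ _ hv0.ne']
          · have : v - (ρ / ‖v‖) • v = (1 - ρ / ‖v‖) • v := by rw [sub_smul, one_smul]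
            have h0 : 0 ≤ 1 - ρ / ‖v‖ := by
              rw [sub_nonneg, div_le_one hv0]; exact hv.le
            rw [this, norm_smul, Real.norm_eq_abs, abs_of_nonneg h0, max_eq_right (by linarith)]
            field_simp
      have hbv : bump ρ δ v = 1 - (‖v - p‖ / δ) ^ 2 := by
        rw [hp2]
        exact max_eq_right h.le
      have hge : ∀ u : Vec d, 1 - (‖u - p‖ / δ) ^ 2 ≤ bump ρ δ u := by
        intro u
        refine le_trans ?_ (le_max_right _ _)
        have h3 : max 0 (‖u‖ - ρ) ≤ ‖u - p‖ :=
          max_le (norm_nonneg _) (by linarith [norm_sub_norm_le u p])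
        gcongr
      have hpar : (‖v + w - p‖ / δ) ^ 2 + (‖v - w - p‖ / δ) ^ 2 =
          2 * (‖v - p‖ / δ) ^ 2 + 2 * (‖w‖ / δ) ^ 2 := by
        have e1 : v + w - p = (v - p) + w := by abel
        have e2 : v - w - p = (v - p) - w := by abel
        have := parallelogram_law_with_norm ℝ (v - p) w
        simp only [div_pow]
        rw [e1, e2, ← add_div]
        have h4 : ‖v - p + w‖ ^ 2 + ‖v - p - w‖ ^ 2 = 2 * ‖v - p‖ ^ 2 + 2 * ‖w‖ ^ 2 := by
          linarith
        rw [h4]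
        ring
      linarith [hge (v + w), hge (v - w)]
  rcases le_or_gt (‖w‖ / δ) 1 with h | h
  · have h0 : 0 ≤ ‖w‖ / δ := by positivity
    have h3 : (‖w‖ / δ) ^ 2 ≤ (‖w‖ / δ) ^ (1 + s) := by
      rcases h0.eq_or_lt with h0 | h0
      · rw [← h0, Real.zero_rpow (by linarith [hs.1])]
        norm_num
      · rw [← Real.rpow_two]
        exact Real.rpow_le_rpow_of_exponent_ge h0 h (by linarith [hs.2])
    have h4 : (‖w‖ / δ) ^ (1 + s) ≤ 1 := Real.rpow_le_one h0 h (by linarith [hs.1])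
    rw [min_eq_left h4]
    linarith
  · rw [min_eq_right (Real.one_le_rpow h.le (by linarith [hs.1]))]
    linarith

/-! ### The singular part at a minimum of `g - lam * bump` -/

/-- Truncated integrals of an even singular kernel against increments of `g`, at a point where
`g - lam * bump` is minimal. -/
theorem truncated_integral_ge {d : ℕ} {k : Vec d → ℝ} (hk0 : ∀ w, 0 ≤ k w)
    (heven : ∀ w, k (-w) = k w) (hkm : AEStronglyMeasurable k) {ρ δ s C : ℝ} (hρ : 0 ≤ ρ)
    (hδ : 0 < δ) (hs : s ∈ Ioo (0 : ℝ) 1)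
    (hI : Integrable fun w => k w * min ((‖w‖ / δ) ^ (1 + s)) 1)
    (hC : ∫ w, k w * min ((‖w‖ / δ) ^ (1 + s)) 1 ≤ C) {g : Vec d → ℝ} {v : Vec d} {lam l : ℝ}
    (hlam : 0 ≤ lam) (hmin : ∀ u, g v - lam * bump ρ δ v ≤ g u - lam * bump ρ δ u)
    {W : Set (Vec d)} (hW : MeasurableSet W)
    (hWl : ∀ w ∈ W, l ≤ g (v + w) - lam * bump ρ δ (v + w) - (g v - lam * bump ρ δ v))
    {ε : ℝ} (hε : 0 < ε) (hWε : ∀ w ∈ W, ε ≤ ‖w‖)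
    (hint : IntegrableOn (fun w => k w * (g (v + w) - g v)) (Metric.ball 0 ε)ᶜ) :
    IntegrableOn k W ∧
    l * (∫ w in W, k w) - lam * C ≤
      ∫ w in (Metric.ball 0 ε)ᶜ, k w * (g (v + w) - g v) := by
  set S : Set (Vec d) := (Metric.ball 0 ε)ᶜ with hS
  have hSm : MeasurableSet S := measurableSet_ball.compl
  have hmemS : ∀ w, w ∈ S ↔ ε ≤ ‖w‖ := fun w => by
    rw [hS, mem_compl_iff, mem_ball_zero_iff, not_lt]
  have hWS : W ⊆ S := fun w hw => (hmemS w).2 (hWε w hw)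
  have hmin0 : ∀ w : Vec d, 0 ≤ min ((‖w‖ / δ) ^ (1 + s)) 1 := fun w =>
    le_min (by positivity) zero_le_one
  have hkS : IntegrableOn k S := by
    set c := min ((ε / δ) ^ (1 + s)) 1 with hc
    have hc0 : 0 < c := lt_min (by positivity) zero_lt_one
    refine Integrable.mono' (hI.const_mul c⁻¹).integrableOn hkm.restrict ?_
    refine (ae_restrict_iff' hSm).2 (Eventually.of_forall fun w hw => ?_)
    rw [Real.norm_eq_abs, abs_of_nonneg (hk0 w)]
    have h1 : c ≤ min ((‖w‖ / δ) ^ (1 + s)) 1 := by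
      refine min_le_min_right _ (Real.rpow_le_rpow (by positivity) ?_ (by linarith [hs.1]))
      have := (hmemS w).1 hw
      gcongr
    calc k w = c⁻¹ * (k w * c) := by field_simp
      _ ≤ _ := by
        have := hk0 w
        gcongr
  refine ⟨hkS.mono_set hWS, ?_⟩
  set φ : Vec d → ℝ := bump ρ δ with hφ
  have hφc : Continuous φ := continuous_bump ρ δ
  have hbdd : ∀ u, ‖φ u - φ v‖ ≤ 1 := by
    intro u
    rw [Real.norm_eq_abs, abs_le]
    constructor <;> linarith [bump_nonneg ρ δ u, bump_le_one ρ δ u, bump_nonneg ρ δ v,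
      bump_le_one ρ δ v]
  have hA1 : IntegrableOn (fun w => k w * (φ (v + w) - φ v)) S :=
    hkS.mul_bdd (c := 1) ((by fun_prop : Continuous fun w => φ (v + w) - φ v).aestronglyMeasurable)
      (Eventually.of_forall fun w => hbdd _)
  have hA2 : IntegrableOn (fun w => k w * (φ (v - w) - φ v)) S :=
    hkS.mul_bdd (c := 1) ((by fun_prop : Continuous fun w => φ (v - w) - φ v).aestronglyMeasurable)
      (Eventually.of_forall fun w => hbdd _)
  have hsymm : ∫ w in S, k w * (φ (v - w) - φ v) = ∫ w in S, k w * (φ (v + w) - φ v) := by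
    have h1 := (Measure.measurePreserving_neg (volume : Measure (Vec d))).setIntegral_preimage_emb
      (Homeomorph.neg (Vec d)).measurableEmbedding (fun w => k w * (φ (v + w) - φ v)) S
    have h2 : (fun w : Vec d => -w) ⁻¹' S = S := by
      ext w
      rw [mem_preimage, hmemS, hmemS, norm_neg]
    rw [← h1]
    change _ = ∫ w in (fun w : Vec d => -w) ⁻¹' S, k (-w) * (φ (v + -w) - φ v)
    rw [h2]
    simp only [heven, ← sub_eq_add_neg]
  have hA : -C ≤ ∫ w in S, k w * (φ (v + w) - φ v) := by
    have h1 : ∫ w in S, -2 * (k w * min ((‖w‖ / δ) ^ (1 + s)) 1) ≤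
        ∫ w in S, (k w * (φ (v + w) - φ v) + k w * (φ (v - w) - φ v)) := by
      refine setIntegral_mono_on (hI.const_mul _).integrableOn (hA1.add hA2) hSm fun w _ => ?_
      have h2 := mul_le_mul_of_nonneg_left (bump_second_difference hρ hδ hs v w) (hk0 w)
      simp only [hφ]
      linarith
    rw [integral_add hA1 hA2, hsymm, integral_const_mul] at h1
    have h2 : ∫ w in S, k w * min ((‖w‖ / δ) ^ (1 + s)) 1 ≤
        ∫ w, k w * min ((‖w‖ / δ) ^ (1 + s)) 1 :=
      setIntegral_le_integral hI (Eventually.of_forall fun w => mul_nonneg (hk0 w) (hmin0 w))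
    linarith
  -- The integrand `D` is the kernel times the increment of `g - lam φ`. It is nonnegative by
  -- minimality, so its integral may be restricted to `W`.
  set D : Vec d → ℝ := fun w => k w * (g (v + w) - g v) - lam * (k w * (φ (v + w) - φ v)) with hD
  have hDeq : ∀ w, D w = k w * (g (v + w) - lam * φ (v + w) - (g v - lam * φ v)) := fun w => by
    simp only [hD]; ring
  have hDint : IntegrableOn D S := hint.sub (hA1.const_mul lam)
  have hD0 : ∀ w, 0 ≤ D w := fun w => by
    rw [hDeq]
    exact mul_nonneg (hk0 w) (sub_nonneg.2 (hmin _))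
  have h1 : l * ∫ w in W, k w ≤ ∫ w in S, D w := by
    rw [← integral_const_mul]
    refine le_trans (setIntegral_mono_on ((hkS.mono_set hWS).const_mul l) (hDint.mono_set hWS) hW
      fun w hw => ?_) (setIntegral_mono_set hDint (Eventually.of_forall hD0) hWS.eventuallyLE)
    rw [hDeq, mul_comm]
    exact mul_le_mul_of_nonneg_left (hWl w hw) (hk0 w)
  have h2 : ∫ w in S, D w = (∫ w in S, k w * (g (v + w) - g v)) -
      lam * ∫ w in S, k w * (φ (v + w) - φ v) := by
    rw [← integral_const_mul]
    exact integral_sub hint (hA1.const_mul lam)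
  have h3 := mul_le_mul_of_nonneg_left hA hlam
  linarith

theorem setIntegral_compl_ball_eq {d : ℕ} (F : Vec d → ℝ) (v : Vec d) (ε : ℝ) :
    ∫ v' in (Metric.ball v ε)ᶜ, F v' = ∫ w in (Metric.ball 0 ε)ᶜ, F (v + w) := by
  have h := (measurePreserving_add_left (volume : Measure (Vec d)) v).setIntegral_preimage_emb
    (Homeomorph.addLeft v).measurableEmbedding F (Metric.ball v ε)ᶜ
  rw [← h]
  congr 2
  ext w
  simp

theorem integrableOn_compl_ball_translate {d : ℕ} {F : Vec d → ℝ} {v : Vec d} {ε : ℝ}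
    (hF : IntegrableOn F (Metric.ball v ε)ᶜ) :
    IntegrableOn (fun w => F (v + w)) (Metric.ball 0 ε)ᶜ := by
  have h := ((measurePreserving_add_left (volume : Measure (Vec d)) v).integrableOn_comp_preimage
    (Homeomorph.addLeft v).measurableEmbedding (f := F) (s := (Metric.ball v ε)ᶜ)).2 hF
  convert! h using 1
  ext w
  simp

/-- The constant in the upper bound of the kernel integrated against the tail weight. -/
noncomputable def lossConst (n : ℕ) (s B M E : ℝ) : ℝ :=
  B * tailConst n s * (9 * M + 2 * E)

/-- Lower bound of the singular part at a point where `g - lam * bump` is minimal. -/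
theorem HasSingularPart.lower_bound {n : ℕ} (hn : 1 ≤ n) {γ s B β₀ : ℝ} (hs : s ∈ Ioo (0 : ℝ) 1)
    (hγs : γ + 2 * s ∈ Icc (0 : ℝ) 2) {b β : ℝ → ℝ}
    (hβ : IsAngularProfile (n + 1) γ s b β B) (hβ₀ : 0 < β₀)
    (hlow : ∀ r ρ : ℝ, 0 < r → r ≤ 12 * ρ → β₀ ≤ β (deviationAngle r ρ))
    {M E : ℝ} {g : Vec (n + 1) → ℝ} (hg : IsDensity M E g)
    {R l ξ : ℝ} (hR : 1 ≤ R) (hl : 0 ≤ l) (hgl : ∀ v ∈ Metric.ball (0 : Vec (n + 1)) R, l ≤ g v)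
    (hξ : 0 < ξ) (hξ1 : ξ < 1 / 3) {v : Vec (n + 1)} (hV1 : R ≤ ‖v‖)
    (hV2 : ‖v‖ < √2 * (1 - ξ / 2) * R) {ρ δ lam : ℝ} (hρ : 0 ≤ ρ) (hδ : 0 < δ) (hlam : 0 ≤ lam)
    (hlaml : lam ≤ l / 2) (hneg : g v - lam * bump ρ δ v ≤ 0)
    (hmin : ∀ u, g v - lam * bump ρ δ v ≤ g u - lam * bump ρ δ u) {q : ℝ}
    (hq : HasSingularPart γ b g g v q) :
    l / 2 * (gainConst n γ s β₀ * l * ξ ^ (n + 2) * (R ^ (n + 1) * R ^ γ)) -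
      lam * (lossConst n s B M E * (δ ^ (-(2 * s)) * R ^ (γ + 2 * s))) ≤ q := by
  have hR0 : 0 < R := by linarith
  have hM : 0 ≤ M := (integral_nonneg hg.nonneg).trans hg.mass_le
  have hE : 0 ≤ E := (integral_nonneg fun u => mul_nonneg (hg.nonneg u) (sq_nonneg _)).trans
    hg.energy_le
  have hB : 0 ≤ B := (hβ.nonneg 0).trans (hβ.le 0)
  have hT := tailConst_pos hn hs
  set C := lossConst n s B M E * (δ ^ (-(2 * s)) * R ^ (γ + 2 * s)) with hC
  have hCeq : B * (tailConst n s * δ ^ (-(2 * s)) * (R ^ (γ + 2 * s) * (9 * M + 2 * E))) = C := by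
    rw [hC, lossConst]; ring
  have hC0 : 0 ≤ C := by rw [← hCeq]; positivity
  have hV3 : ‖v‖ ≤ 2 * R := by
    have h2 : √2 ≤ 2 := Real.sqrt_le_iff.2 ⟨by norm_num, by norm_num⟩
    have h3 : √2 * (1 - ξ / 2) ≤ 2 * 1 :=
      mul_le_mul h2 (by linarith) (by linarith) (by norm_num)
    nlinarith
  set k := reducedKernel γ s β g v with hk
  have hk0 : ∀ w, 0 ≤ k w := reducedKernel_nonneg hβ.nonneg hg.nonneg v
  have hw0 : ∀ᵐ w : Vec (n + 1), w ≠ 0 :=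
    measure_eq_zero_iff_ae_notMem.1 (measure_singleton (0 : Vec (n + 1)))
  have hkm : AEStronglyMeasurable k := by
    obtain ⟨k', hk', hkk⟩ := exists_measurable_eq_reducedKernel (d := n + 1) (by omega) (γ := γ)
      (s := s) hβ.continuous hg.continuous v
    exact ⟨k', hk'.stronglyMeasurable, hw0.mono fun w hw => hkk w hw⟩
  obtain ⟨hup, hfin⟩ := lintegral_reducedKernel_mul_le hn hs hγs hβ.continuous hβ.nonneg hβ.le hg
    hR hδ hV3
  rw [hCeq] at hup
  have hmin0 : ∀ w : Vec (n + 1), 0 ≤ min ((‖w‖ / δ) ^ (1 + s)) 1 := fun w =>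
    le_min (by positivity) zero_le_one
  have hkw0 : ∀ w, 0 ≤ k w * min ((‖w‖ / δ) ^ (1 + s)) 1 := fun w =>
    mul_nonneg (hk0 w) (hmin0 w)
  have hmw : Measurable fun w : Vec (n + 1) => min ((‖w‖ / δ) ^ (1 + s)) 1 :=
    ((measurable_norm.div_const δ).pow_const (1 + s)).min measurable_const
  have hkwm : AEStronglyMeasurable fun w => k w * min ((‖w‖ / δ) ^ (1 + s)) 1 :=
    hkm.mul hmw.aestronglyMeasurable
  have hI : Integrable fun w => k w * min ((‖w‖ / δ) ^ (1 + s)) 1 := by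
    refine ⟨hkwm, ?_⟩
    rw [hasFiniteIntegral_iff_ofReal (Eventually.of_forall hkw0)]
    exact hup.trans_lt ENNReal.ofReal_lt_top
  have hIle : ∫ w, k w * min ((‖w‖ / δ) ^ (1 + s)) 1 ≤ C := by
    rw [integral_eq_lintegral_of_nonneg_ae (Eventually.of_forall hkw0) hkwm]
    exact ENNReal.toReal_le_of_le_ofReal hC0 hup
  set W := diagonalShell v (ξ * R / 32) with hW
  have hgeo := fun w (hw : w ∈ W) => diagonalShell_geometry hR hξ hξ1 hV1 hV2 hw
  have hWl : ∀ w ∈ W,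
      l / 2 ≤ g (v + w) - lam * bump ρ δ (v + w) - (g v - lam * bump ρ δ v) := by
    intro w hw
    have h1 := hgl (v + w) (mem_ball_zero_iff.2 (hgeo w hw).2.2.1)
    have h2 : lam * bump ρ δ (v + w) ≤ lam * 1 :=
      mul_le_mul_of_nonneg_left (bump_le_one ρ δ (v + w)) hlam
    linarith
  refine ge_of_tendsto hq.2 ?_
  -- For `ε < R/4` the shell lies outside the removed ball, and the bound does not depend on `ε`, so
  -- it passes to the principal value.
  filter_upwards [Ioo_mem_nhdsGT (show (0 : ℝ) < R / 4 by positivity)] with ε hε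
  have hi := integrableOn_compl_ball_translate (hq.1 ε hε.1)
  rw [setIntegral_compl_ball_eq]
  have hSm : MeasurableSet (Metric.ball (0 : Vec (n + 1)) ε)ᶜ := measurableSet_ball.compl
  have hcongr : EqOn (fun w => carlemanKernel γ b g v (v + w) * (g (v + w) - g v))
      (fun w => k w * (g (v + w) - g v)) (Metric.ball (0 : Vec (n + 1)) ε)ᶜ := by
    intro w hw
    have hwne : v + w ≠ v := by
      intro h
      rw [add_eq_left] at h
      rw [h, mem_compl_iff, mem_ball_zero_iff, norm_zero] at hw
      exact hw hε.1
    simp only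
    rw [carlemanKernel_eq_reducedKernel (by omega) hβ g hwne, add_sub_cancel_left]
  rw [setIntegral_congr_fun hSm hcongr]
  obtain ⟨h1, h2⟩ := truncated_integral_ge hk0 (reducedKernel_neg g v) hkm hρ hδ hs hI hIle hlam
    hmin (measurableSet_diagonalShell _ _) hWl hε.1
    (fun w hw => hε.2.le.trans (hgeo w hw).1) (hi.congr_fun hcongr hSm)
  have h3 := le_setIntegral_reducedKernel hn hγs.1 hs.1.le hβ hβ₀ hlow hg.continuous hg.nonneg hR
    hl hgl hξ hξ1 hV1 hV2 hfin h1
  refine le_trans ?_ h2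
  gcongr

/-! ### Existence of a negative minimum on the torus -/

theorem isCompact_cube (d : ℕ) (L : ℝ) : IsCompact {x : Vec d | ∀ i, x i ∈ Icc 0 L} := by
  have h := (isCompact_univ_pi fun _ : Fin d => isCompact_Icc (a := (0 : ℝ)) (b := L)).image
    (PiLp.continuous_toLp 2 fun _ : Fin d => ℝ)
  convert! h using 1
  ext x
  constructor
  · exact fun hx => ⟨WithLp.ofLp x, fun i _ => hx i, rfl⟩
  · rintro ⟨y, hy, rfl⟩ i
    exact hy i (mem_univ i)

/-- Every point of `ℝᵈ` has a representative in the cube, modulo the lattice `L ℤᵈ`. -/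
theorem exists_mem_cube {d : ℕ} {L : ℝ} (hL : 0 < L) (x : Vec d) :
    ∃ y : Vec d, (∀ i, y i ∈ Icc 0 L) ∧ ∀ h : Vec d → ℝ,
      (∀ z, ∀ i : Fin d, h (z + EuclideanSpace.single i L) = h z) → h y = h x := by
  classical
  refine ⟨x + ∑ i, (-⌊x i / L⌋) • EuclideanSpace.single i L, fun j => ?_, fun h hper => ?_⟩
  · have h1 : (x + ∑ i, (-⌊x i / L⌋) • EuclideanSpace.single i L) j = x j - ⌊x j / L⌋ * L := by
      rw [PiLp.add_apply, WithLp.ofLp_sum, Finset.sum_apply, Finset.sum_eq_single j]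
      · simp
        ring
      · intro i _ hij
        simp [hij.symm]
      · simp
    have h2 := Int.floor_le (x j / L)
    have h3 := Int.lt_floor_add_one (x j / L)
    rw [le_div_iff₀ hL] at h2
    rw [div_lt_iff₀ hL] at h3
    rw [h1]
    constructor <;> linarith
  · have key : ∀ s : Finset (Fin d),
        h (x + ∑ i ∈ s, (-⌊x i / L⌋) • EuclideanSpace.single i L) = h x := by
      intro s
      induction s using Finset.induction_on with
      | empty => simp
      | insert i s hi ih =>
        have hp : Function.Periodic h (EuclideanSpace.single i L) := fun z => hper z i
        rw [Finset.sum_insert hi, add_comm (_ • _), ← add_assoc, hp.zsmul, ih]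
    exact key Finset.univ

/-- Since `f ≥ 0`, negative values occur only where `|v| ≤ r`, and periodicity brings `x` into a
cube. A minimum over this compact set is therefore global. -/
theorem IsSupersolution.exists_negative_min {d : ℕ} {γ L T : ℝ} {b : ℝ → ℝ}
    {f : ℝ → Vec d → Vec d → ℝ} (hf : IsSupersolution γ b L T f) (hL : 0 < L) {lam : ℝ → ℝ}
    (hlam : Continuous lam) {φ : Vec d → ℝ} (hφ : Continuous φ) {r : ℝ}
    (hφr : ∀ v, r < ‖v‖ → φ v = 0) {t₁ : ℝ} (ht₁ : t₁ ∈ Icc 0 T) {x₁ v₁ : Vec d}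
    (hneg : f t₁ x₁ v₁ - lam t₁ * φ v₁ < 0) :
    ∃ t₀ ∈ Icc 0 T, ∃ x₀ v₀, f t₀ x₀ v₀ - lam t₀ * φ v₀ < 0 ∧
      ∀ t ∈ Icc 0 T, ∀ x v, f t₀ x₀ v₀ - lam t₀ * φ v₀ ≤ f t x v - lam t * φ v := by
  set F : ℝ × Vec d × Vec d → ℝ := fun p => f p.1 p.2.1 p.2.2 - lam p.1 * φ p.2.2 with hF
  set K : Set (ℝ × Vec d × Vec d) :=
    Icc 0 T ×ˢ ({x : Vec d | ∀ i, x i ∈ Icc 0 L} ×ˢ Metric.closedBall (0 : Vec d) r) with hK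
  have hKc : IsCompact K :=
    isCompact_Icc.prod ((isCompact_cube d L).prod (isCompact_closedBall 0 r))
  have hFc : ContinuousOn F K := by
    refine ContinuousOn.sub (hf.continuousOn.mono ?_) (Continuous.continuousOn (by fun_prop))
    exact prod_mono le_rfl (subset_univ _)
  have hred : ∀ t ∈ Icc 0 T, ∀ x v, f t x v - lam t * φ v < 0 →
      ∃ p ∈ K, F p = f t x v - lam t * φ v := by
    intro t ht x v hlt
    obtain ⟨y, hy, hper⟩ := exists_mem_cube hL x
    have h1 := hper (fun z => f t z v) fun z i => hf.periodic t ht z v i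
    refine ⟨(t, y, v), ⟨ht, hy, ?_⟩, ?_⟩
    · by_contra h
      rw [mem_closedBall_zero_iff, not_le] at h
      rw [hφr v h, mul_zero, sub_zero] at hlt
      exact absurd (hf.nonneg t ht x v) (not_le.2 hlt)
    · simp only [hF, h1]
  obtain ⟨p₁, hp₁, hFp₁⟩ := hred t₁ ht₁ x₁ v₁ hneg
  obtain ⟨p₀, hp₀, hmin⟩ := hKc.exists_isMinOn ⟨p₁, hp₁⟩ hFc
  have hp₀neg : F p₀ < 0 := lt_of_le_of_lt (hmin hp₁) (hFp₁ ▸ hneg)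
  refine ⟨p₀.1, hp₀.1, p₀.2.1, p₀.2.2, hp₀neg, fun t ht x v => ?_⟩
  rcases lt_or_ge (f t x v - lam t * φ v) 0 with h | h
  · obtain ⟨p, hp, hFp⟩ := hred t ht x v h
    rw [← hFp]
    exact hmin hp
  · exact hp₀neg.le.trans h

/-- Only difference quotients from the left are used, so the minimum may occur at the final time. -/
theorem deriv_nonpos_of_min_Icc {G : ℝ → ℝ} {G' T t₀ : ℝ} (ht₀ : 0 < t₀)
    (ht₀T : t₀ ≤ T) (hG : HasDerivWithinAt G G' (Icc 0 T) t₀)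
    (hmin : ∀ t ∈ Icc 0 T, G t₀ ≤ G t) : G' ≤ 0 := by
  have h1 : HasDerivWithinAt G G' (Ico 0 t₀) t₀ :=
    hG.mono fun t ht => ⟨ht.1, ht.2.le.trans ht₀T⟩
  have h2 := (hasDerivWithinAt_iff_tendsto_slope' (fun h => lt_irrefl _ h.2)).1 h1
  have : (𝓝[Ico 0 t₀] t₀).NeBot := by
    rw [← mem_closure_iff_nhdsWithin_neBot, closure_Ico ht₀.ne]
    exact right_mem_Icc.2 ht₀.le
  refine le_of_tendsto h2 (eventually_mem_nhdsWithin.mono fun t ht => ?_)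
  rw [slope_def_field]
  exact div_nonpos_of_nonneg_of_nonpos (sub_nonneg.2 (hmin t ⟨ht.1, ht.2.le.trans ht₀T⟩))
    (sub_nonpos.2 ht.2.le)

/-! ### The barrier in time -/

/-- The solution of `lam' = A - Λ lam`, `lam 0 = 0`. -/
noncomputable def barrier (A Λ t : ℝ) : ℝ := A * (1 - Real.exp (-(Λ * t))) / Λ

theorem hasDerivAt_barrier {A Λ : ℝ} (hΛ : 0 < Λ) (t : ℝ) :
    HasDerivAt (barrier A Λ) (A - Λ * barrier A Λ t) t := by
  have h1 : HasDerivAt (fun t => -(Λ * t)) (-(Λ * 1)) t := ((hasDerivAt_id t).const_mul Λ).neg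
  have h2 := ((h1.exp.const_sub 1).const_mul A).div_const Λ
  convert! h2 using 1
  unfold barrier
  field_simp
  ring

theorem barrier_zero (A Λ : ℝ) : barrier A Λ 0 = 0 := by simp [barrier]

theorem barrier_nonneg {A Λ t : ℝ} (hA : 0 ≤ A) (hΛ : 0 < Λ) (ht : 0 ≤ t) :
    0 ≤ barrier A Λ t := by
  have : Real.exp (-(Λ * t)) ≤ 1 := Real.exp_le_one_iff.2 (by
    have := mul_nonneg hΛ.le ht
    linarith)
  exact div_nonneg (mul_nonneg hA (by linarith)) hΛ.le

theorem barrier_le {A Λ t : ℝ} (hA : 0 ≤ A) (hΛ : 0 < Λ) : barrier A Λ t ≤ A * t := by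
  have := Real.one_sub_le_exp_neg (Λ * t)
  rw [barrier, div_le_iff₀ hΛ]
  calc A * (1 - Real.exp (-(Λ * t))) ≤ A * (Λ * t) := by gcongr; linarith
    _ = _ := by ring

theorem barrier_deriv_nonneg {A Λ t : ℝ} (hA : 0 ≤ A) (hΛ : 0 < Λ) :
    0 ≤ A - Λ * barrier A Λ t := by
  have : A - Λ * barrier A Λ t = A * Real.exp (-(Λ * t)) := by
    unfold barrier
    field_simp
    ring
  rw [this]
  positivity

/-- Follows from `1 - e^(-x) ≥ x/(1+x) ≥ min(x, 1)/2` at `x = Λ t`. -/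
theorem le_barrier {A Λ t : ℝ} (hA : 0 ≤ A) (hΛ : 0 < Λ) (ht : 0 ≤ t) :
    A / 2 * min t Λ⁻¹ ≤ barrier A Λ t := by
  set x := Λ * t with hx
  have hx0 : 0 ≤ x := mul_nonneg hΛ.le ht
  have h1 : Real.exp (-x) ≤ (1 + x)⁻¹ := by
    rw [Real.exp_neg]
    exact inv_anti₀ (by positivity) (by linarith [Real.add_one_le_exp x])
  have h2 : min x 1 / 2 ≤ 1 - Real.exp (-x) := by
    have h3 : min x 1 / 2 ≤ 1 - (1 + x)⁻¹ := by
      have h4 : 1 - (1 + x)⁻¹ = x / (1 + x) := by field_simp; ring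
      rw [h4, div_le_div_iff₀ two_pos (by positivity)]
      rcases le_total x 1 with h | h
      · rw [min_eq_left h]; nlinarith
      · rw [min_eq_right h]; linarith
    linarith
  have h5 : min t Λ⁻¹ = min x 1 / Λ := by
    rw [← min_div_div_right hΛ.le, hx, mul_div_cancel_left₀ _ hΛ.ne', one_div]
  rw [h5, barrier, ← hx]
  calc A / 2 * (min x 1 / Λ) = A * (min x 1 / 2) / Λ := by ring
    _ ≤ _ := by gcongr

/-! ### First contact and comparison with the barrier -/

theorem HydrodynamicBounds.isDensity {d : ℕ} {γ L T M E : ℝ} {b : ℝ → ℝ}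
    {f : ℝ → Vec d → Vec d → ℝ} (hf : IsSupersolution γ b L T f) (hME : HydrodynamicBounds M E T f)
    {t : ℝ} (ht : t ∈ Icc 0 T) (x : Vec d) : IsDensity M E (f t x) where
  continuous := (hf.differentiable_v t ht x).continuous
  nonneg := hf.nonneg t ht x
  integrable_mass := (hME t ht x).1.1
  mass_le := (hME t ht x).1.2
  integrable_energy := (hME t ht x).2.1
  energy_le := (hME t ht x).2.2

/-- First contact of a supersolution with a moving barrier: at a negative minimum of
`f - lam * φ` the singular part is at most the speed of the barrier. -/
theorem IsSupersolution.exists_contact {d : ℕ} {γ L T : ℝ} {b : ℝ → ℝ}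
    {f : ℝ → Vec d → Vec d → ℝ} (hf : IsSupersolution γ b L T f) (hL : 0 < L) {lam lam' : ℝ → ℝ}
    (hlam : ∀ t, HasDerivAt lam (lam' t) t) (hlam0 : lam 0 = 0) {φ : Vec d → ℝ}
    (hφ : Continuous φ) {r : ℝ} (hφr : ∀ v, r < ‖v‖ → φ v = 0) {t₁ : ℝ} (ht₁ : t₁ ∈ Icc 0 T)
    {x₁ v₁ : Vec d} (hneg : f t₁ x₁ v₁ - lam t₁ * φ v₁ < 0) :
    ∃ t ∈ Icc 0 T, ∃ x v q, f t x v - lam t * φ v < 0 ∧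
      (∀ u, f t x v - lam t * φ v ≤ f t x u - lam t * φ u) ∧
      HasSingularPart γ b (f t x) (f t x) v q ∧ q ≤ lam' t * φ v := by
  obtain ⟨t, ht, x, v, hn, hmin⟩ := hf.exists_negative_min hL
    (continuous_iff_continuousAt.2 fun t => (hlam t).continuousAt) hφ hφr ht₁ hneg
  obtain ⟨q, hq, hle⟩ := hf.supersolution t ht x v
  refine ⟨t, ht, x, v, q, hn, hmin t ht x, hq, hle.trans ?_⟩
  have ht0 : 0 < t := by
    refine lt_of_le_of_ne ht.1 fun h => ?_
    rw [← h, hlam0, zero_mul, sub_zero] at hn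
    exact absurd (hf.nonneg 0 (h ▸ ht) x v) (not_le.2 hn)
  have hx : fderiv ℝ (fun y => f t y v) x = 0 := by
    refine IsLocalMin.fderiv_eq_zero (Eventually.of_forall fun y => ?_)
    have := hmin t ht y v
    simpa using this
  have hd := (hf.differentiable_t x v t ht).hasDerivWithinAt
  have h1 := hd.sub (((hlam t).mul_const (φ v)).hasDerivWithinAt (s := Icc 0 T))
  have h2 := deriv_nonpos_of_min_Icc ht0 ht.2 h1 fun t' ht' => hmin t' ht' x v
  rw [hx]
  simpa using h2

/-- The spreading of lower bounds, at the level of the barrier. -/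
theorem IsSupersolution.barrier_le {n : ℕ} (hn : 1 ≤ n) {γ s B β₀ : ℝ} (hs : s ∈ Ioo (0 : ℝ) 1)
    (hγs : γ + 2 * s ∈ Icc (0 : ℝ) 2) {b β : ℝ → ℝ}
    (hβ : IsAngularProfile (n + 1) γ s b β B) (hβ₀ : 0 < β₀)
    (hlow : ∀ r ρ : ℝ, 0 < r → r ≤ 12 * ρ → β₀ ≤ β (deviationAngle r ρ))
    {M E L T : ℝ} (hL : 0 < L) (hT : T ≤ 1) {f : ℝ → Vec (n + 1) → Vec (n + 1) → ℝ}
    (hf : IsSupersolution γ b L T f) (hME : HydrodynamicBounds M E T f)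
    {l R : ℝ} (hl : 0 < l) (hR : 1 ≤ R)
    (hfl : ∀ t ∈ Icc 0 T, ∀ x, ∀ v ∈ Metric.ball (0 : Vec (n + 1)) R, l ≤ f t x v)
    {ξ : ℝ} (hξ : 0 < ξ) (hξ1 : ξ < 1 / 3) {A Λ : ℝ} (hA : 0 ≤ A) (hΛ : 0 < Λ)
    (hAl : A ≤ l / 2)
    (hAgain : A < l / 2 * (gainConst n γ s β₀ * l * ξ ^ (n + 2) * (R ^ (n + 1) * R ^ γ)))
    (hΛloss : lossConst n s B M E * ((√2 / 2 * ξ * R) ^ (-(2 * s)) * R ^ (γ + 2 * s)) ≤ Λ)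
    {t : ℝ} (ht : t ∈ Icc 0 T) (x : Vec (n + 1)) {v : Vec (n + 1)}
    (hv : ‖v‖ ≤ √2 * (1 - ξ) * R) : barrier A Λ t ≤ f t x v := by
  have hR0 : 0 < R := by linarith
  have h2 : 0 < √2 := by positivity
  set ρ := √2 * (1 - ξ) * R with hρ
  set δ := √2 / 2 * ξ * R with hδ
  have hρ0 : 0 ≤ ρ := mul_nonneg (mul_nonneg h2.le (by linarith)) hR0.le
  have hδ0 : 0 < δ := by positivity
  have hρδ : ρ + δ = √2 * (1 - ξ / 2) * R := by rw [hρ, hδ]; ring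
  by_contra hcon
  have hneg : f t x v - barrier A Λ t * bump ρ δ v < 0 := by
    rw [bump_eq_one hv]
    linarith
  obtain ⟨t₀, ht₀, x₀, v₀, q, hn₀, hmin, hq, hle⟩ := hf.exists_contact hL
    (fun t => hasDerivAt_barrier hΛ t) (barrier_zero A Λ) (continuous_bump ρ δ)
    (fun v (hv : ρ + δ < ‖v‖) => bump_eq_zero hδ0 hv.le) ht hneg
  set lam := barrier A Λ t₀ with hlam
  have hlam0 : 0 ≤ lam := barrier_nonneg hA hΛ ht₀.1
  have hlaml : lam ≤ l / 2 := by
    have h1 : lam ≤ A * t₀ := Boltzmann.barrier_le hA hΛ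
    have h3 : A * t₀ ≤ A * 1 := mul_le_mul_of_nonneg_left (ht₀.2.trans hT) hA
    linarith
  -- Contact cannot occur in `B_R`, where `f ≥ l > lam`, nor outside the support of the bump, where
  -- `f ≥ 0`.
  have hV1 : R ≤ ‖v₀‖ := by
    by_contra h
    have h1 := hfl t₀ ht₀ x₀ v₀ (mem_ball_zero_iff.2 (not_le.1 h))
    have h3 : lam * bump ρ δ v₀ ≤ lam * 1 :=
      mul_le_mul_of_nonneg_left (bump_le_one ρ δ v₀) hlam0
    linarith
  have hV2 : ‖v₀‖ < √2 * (1 - ξ / 2) * R := by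
    rw [← hρδ]
    by_contra h
    rw [bump_eq_zero hδ0 (not_lt.1 h), mul_zero, sub_zero] at hn₀
    exact absurd (hf.nonneg t₀ ht₀ x₀ v₀) (not_le.2 hn₀)
  have h3 := hq.lower_bound hn hs hγs hβ hβ₀ hlow (hME.isDensity hf ht₀ x₀) hR hl.le
    (hfl t₀ ht₀ x₀) hξ hξ1 hV1 hV2 hρ0 hδ0 hlam0 hlaml hn₀.le hmin
  -- Contact gives `q ≤ (A - Λ lam) φ`, and the bump may be replaced by 1 because the barrier is
  -- nondecreasing. The gain exceeds `A` and the loss is at most `Λ lam`, so also `q > A - Λ lam`.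
  have h4 : (A - Λ * lam) * bump ρ δ v₀ ≤ (A - Λ * lam) * 1 :=
    mul_le_mul_of_nonneg_left (bump_le_one ρ δ v₀) (barrier_deriv_nonneg hA hΛ)
  have h5 := mul_le_mul_of_nonneg_left hΛloss hlam0
  linarith

end Boltzmann

/-! ### Choice of the constants -/

theorem lemma3p3 (d : ℕ) (hd : 2 ≤ d) (γ s : ℝ) (hs : s ∈ Ioo (0 : ℝ) 1)
    (hγs : γ + 2 * s ∈ Icc (0 : ℝ) 2) (b : ℝ → ℝ) (hb : Boltzmann.IsNonCutoffKernel d γ s b)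
    (M₀ E₀ : ℝ) :
    ∃ c : ℝ, 0 < c ∧
      ∀ (L T₀ : ℝ) (_hL : 0 < L) (_hT₀ : T₀ ∈ Ioo (0 : ℝ) 1)
        (f : ℝ → Boltzmann.Vec d → Boltzmann.Vec d → ℝ)
        (_hf : Boltzmann.IsSupersolution γ b L T₀ f)
        (_hME : Boltzmann.HydrodynamicBounds M₀ E₀ T₀ f)
        (l R : ℝ) (_hl : 0 < l) (_hR : 1 ≤ R)
        (_hlow : ∀ t ∈ Icc 0 T₀, ∀ x, ∀ v ∈ Metric.ball (0 : Boltzmann.Vec d) R, l ≤ f t x v)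
        (ξ q : ℝ) (_hξ : ξ ∈ Ioo (0 : ℝ) (1 - 1 / Real.sqrt 2))
        (_hq : q = d + 2 * (γ + 2 * s + 1))
        (_hsmall : ξ ^ q * R ^ ((d : ℝ) + γ) * l < 1 / 2),
        ∀ t ∈ Icc 0 T₀, ∀ x,
          ∀ v ∈ Metric.ball (0 : Boltzmann.Vec d) (Real.sqrt 2 * (1 - ξ) * R),
            c * ξ ^ q * R ^ ((d : ℝ) + γ) * l ^ 2 * min t (R ^ (-γ) * ξ ^ (2 * s)) ≤ f t x v := by
  obtain ⟨n, rfl⟩ : ∃ n, d = n + 1 := ⟨d - 1, by omega⟩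
  have hn : 1 ≤ n := by omega
  obtain ⟨β, B, hβ⟩ := hb.exists_profile
  obtain ⟨β₀, hβ₀, hβlow⟩ := hβ.exists_lower_bound
  set G := Boltzmann.gainConst n γ s β₀ with hG
  have hG0 : 0 < G := Boltzmann.gainConst_pos hβ₀
  -- The bound `a ≤ 1` and the smallness hypothesis give `A ≤ l/2`; `a ≤ G/4` keeps `A` strictly
  -- below the gain, which carries the factor `G/2`.
  set a := min (G / 4) 1 with ha
  have ha0 : 0 < a := lt_min (by positivity) zero_lt_one
  set C := max 1 (Boltzmann.lossConst n s B M₀ E₀ * (√2 / 2) ^ (-(2 * s))) with hC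
  have hC1 : 1 ≤ C := le_max_left _ _
  have hC0 : 0 < C := by linarith
  refine ⟨a / (2 * C), by positivity, ?_⟩
  intro L T₀ hL hT₀ f hf hME l R hl hR hlow ξ q hξ hq hsmall t ht x v hv
  have hR0 : 0 < R := by linarith
  have hξ0 := hξ.1
  have hξ1 : ξ < 1 / 3 := by
    refine hξ.2.trans ?_
    have h1 : √2 < 3 / 2 := by
      rw [Real.sqrt_lt' (by norm_num)]
      norm_num
    have h2 : (2 : ℝ) / 3 < 1 / √2 := by
      rw [div_lt_div_iff₀ (by norm_num) (by positivity)]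
      linarith
    linarith
  set X := ξ ^ q * R ^ (((n + 1 : ℕ) : ℝ) + γ) with hX
  have hX0 : 0 < X := by positivity
  have hXle : X ≤ ξ ^ (n + 2) * (R ^ (n + 1) * R ^ γ) := by
    -- The gain only costs `ξ^(d+1)`; since `q ≥ d + 2` and `ξ < 1`, the claimed power is weaker.
    have h1 : ξ ^ q ≤ ξ ^ (n + 2) := by
      rw [← Real.rpow_natCast]
      refine Real.rpow_le_rpow_of_exponent_ge hξ0 (by linarith) ?_
      rw [hq]
      push_cast
      linarith [hγs.1]
    have h2 : R ^ (((n + 1 : ℕ) : ℝ) + γ) = R ^ (n + 1) * R ^ γ := by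
      rw [Real.rpow_add hR0, Real.rpow_natCast]
    rw [hX, h2]
    gcongr
  set Λ := C * (ξ ^ (-(2 * s)) * R ^ γ) with hΛ
  have hΛ0 : 0 < Λ := by positivity
  have hmain : Boltzmann.barrier (a * X * l ^ 2) Λ t ≤ f t x v := by
    refine hf.barrier_le hn hs hγs hβ hβ₀ hβlow hL hT₀.2.le hME hl hR hlow hξ0 hξ1
      (by positivity) hΛ0 ?_ ?_ ?_ ht x (mem_ball_zero_iff.1 hv).le
    · calc a * X * l ^ 2 = a * (X * l) * l := by ring
        _ ≤ 1 * (1 / 2) * l := by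
          have := min_le_right (G / 4) 1
          gcongr
        _ = l / 2 := by ring
    · have h1 : a ≤ G / 4 := min_le_left _ _
      calc a * X * l ^ 2 ≤ G / 4 * X * l ^ 2 := by gcongr
        _ < G / 2 * X * l ^ 2 := by gcongr; norm_num
        _ ≤ G / 2 * (ξ ^ (n + 2) * (R ^ (n + 1) * R ^ γ)) * l ^ 2 := by gcongr
        _ = _ := by ring
    · have h1 : (√2 / 2 * ξ * R) ^ (-(2 * s)) * R ^ (γ + 2 * s) =
          (√2 / 2) ^ (-(2 * s)) * (ξ ^ (-(2 * s)) * R ^ γ) := by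
        rw [Real.mul_rpow (by positivity) hR0.le, Real.mul_rpow (by positivity) hξ0.le]
        have h2 : R ^ (-(2 * s)) * R ^ (γ + 2 * s) = R ^ γ := by
          rw [← Real.rpow_add hR0]
          ring_nf
        rw [mul_assoc, h2, mul_assoc]
      rw [h1, ← mul_assoc]
      exact mul_le_mul_of_nonneg_right (le_max_right _ _) (by positivity)
  refine le_trans ?_ ((Boltzmann.le_barrier (by positivity) hΛ0 ht.1).trans hmain)
  have hΛinv : Λ⁻¹ = C⁻¹ * (R ^ (-γ) * ξ ^ (2 * s)) := by
    rw [hΛ, mul_inv, mul_inv, ← Real.rpow_neg hξ0.le, ← Real.rpow_neg hR0.le, neg_neg]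
    ring
  -- The bound `C ≥ 1` allows `C⁻¹` to be pulled out of the minimum, at the cost of `C⁻¹ t ≤ t`.
  have hmin : C⁻¹ * min t (R ^ (-γ) * ξ ^ (2 * s)) ≤ min t Λ⁻¹ := by
    rw [hΛinv, mul_min_of_nonneg _ _ (by positivity)]
    refine min_le_min_right _ ?_
    exact mul_le_of_le_one_left ht.1 (inv_le_one_of_one_le₀ hC1)
  calc _ = a * X * l ^ 2 / 2 * (C⁻¹ * min t (R ^ (-γ) * ξ ^ (2 * s))) := by
        rw [hX]
        field_simp
    _ ≤ _ := by gcongr
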